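/- Let $K$ be a field of characteristic zero and let $a\in K\setminus\{-1,0,1/2,1,2\}$. Let $Q(a)$ be the quartic form $$\begin{aligned}Q(a)={}&2ax^3y+4ax^2y^2+2axy^3-(2a-1)(a-2)x^3z-(5a^2-17a+5)x^2yz-3(a^2-4a+1)xy^2z+ay^3z\\&-3(2a-1)(a-2)x^2z^2-(7a^2-19a+7)xyz^2+2ay^2z^2-2(2a-1)(a-2)xz^3+ayz^3\\&-2atx^2y-2atxy^2+2(2a-1)(a-2)tx^2z+4(a^2-3a+1)txyz-2aty^2z+2(2a-1)(a-2)txz^2-2atyz^2.\end{aligned}$$ Let $\mathrm{PGL}(4,K)$ act on $\mathbb P^3_K$ by multiplying columns of homogeneous coordinates $(x,y,z,t)$, and on quartic forms, up to nonzero scalars, by $\mathcal M\cdot F=F(\mathcal M^{-1}\cdot{}^t(x,y,z,t))$. Let $G_a\subseteq\mathrm{PGL}(4,K)$ be the stabiliser of the surface $Q(a)=0$, regarded as a set of points of $\mathbb P^3_K$. An element $\mathcal M\in\mathrm{PGL}(4,K)$ lies in $G_a$ if and only if $\mathcal M\cdot Q(a)$ is a nonzero scalar multiple of $Q(a)$.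 Moreover: 1. If $a$ is not a root of $x^2-x+1$, then $G_a$ is isomorphic to the symmetric group $S_3$ and is generated by the classes of $$\begin{pmatrix}2&2&2&0\\0&-2&0&0\\-2&0&0&0\\0&1&3&-2\end{pmatrix},\qquad\begin{pmatrix}2&2&2&0\\0&-2&0&0\\0&0&-2&0\\0&-2&-3&2\end{pmatrix}.$$ 2. If $a=\varepsilon$ is a root of $x^2-x+1$, then $Q(\varepsilon)$ is a nonzero scalar multiple of $$\begin{aligned}Q'={}&x^3y+2x^2y^2+xy^3+\tfrac32x^3z+6x^2yz+\tfrac92xy^2z+\tfrac12y^3z+\tfrac92x^2z^2+6xyz^2+y^2z^2+3xz^3+\tfrac12yz^3\\&-x^2yt-xy^2t-3x^2zt-4xyzt-y^2zt-3xz^2t-yz^2t,\end{aligned}$$ and $G_\varepsilon$ has order $18$, is isomorphic to $S_3\times C_3$ ($C_3$ cyclic of order $3$), and is generated by the classes of $$\begin{pmatrix}2&2&2&0\\0&-2&0&0\\0&0&-2&0\\0&-2&-3&2\end{pmatrix},\qquad\begin{pmatrix}0&2\varepsilon-2&2\varepsilon-4&0\\0&-4\varepsilon+2&0&0\\2\varepsilon-4&2\varepsilon-2&0&0\\-3&-3\varepsilon&-3\varepsilon&4\varepsilon-2\end{pmatrix}.$$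 -/

import Mathlib

open MvPolynomial Matrix
open scoped MatrixGroups LinearAlgebra.Projectivization Pointwise

namespace QuarticMonoid

variable {K : Type*} [Field K]

/-- The quartic form `Q(a)` in the variables `x = X 0`, `y = X 1`, `z = X 2`, `t = X 3`. -/
noncomputable def Q (a : K) : MvPolynomial (Fin 4) K :=
  let x : MvPolynomial (Fin 4) K := X 0
  let y : MvPolynomial (Fin 4) K := X 1
  let z : MvPolynomial (Fin 4) K := X 2
  let t : MvPolynomial (Fin 4) K := X 3
  C (2 * a) * x ^ 3 * y + C (4 * a) * x ^ 2 * y ^ 2 + C (2 * a) * x * y ^ 3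
    - C ((2 * a - 1) * (a - 2)) * x ^ 3 * z
    - C (5 * a ^ 2 - 17 * a + 5) * x ^ 2 * y * z
    - C (3 * (a ^ 2 - 4 * a + 1)) * x * y ^ 2 * z + C a * y ^ 3 * z
    - C (3 * (2 * a - 1) * (a - 2)) * x ^ 2 * z ^ 2
    - C (7 * a ^ 2 - 19 * a + 7) * x * y * z ^ 2 + C (2 * a) * y ^ 2 * z ^ 2
    - C (2 * (2 * a - 1) * (a - 2)) * x * z ^ 3 + C a * y * z ^ 3
    - C (2 * a) * t * x ^ 2 * y - C (2 * a) * t * x * y ^ 2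
    + C (2 * (2 * a - 1) * (a - 2)) * t * x ^ 2 * z
    + C (4 * (a ^ 2 - 3 * a + 1)) * t * x * y * z - C (2 * a) * t * y ^ 2 * z
    + C (2 * (2 * a - 1) * (a - 2)) * t * x * z ^ 2 - C (2 * a) * t * y * z ^ 2

/-- The quartic form `Q'`, in the same variables. -/
noncomputable def Q' (K : Type*) [Field K] : MvPolynomial (Fin 4) K :=
  let x : MvPolynomial (Fin 4) K := X 0
  let y : MvPolynomial (Fin 4) K := X 1
  let z : MvPolynomial (Fin 4) K := X 2
  let t : MvPolynomial (Fin 4) K := X 3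
  x ^ 3 * y + 2 * x ^ 2 * y ^ 2 + x * y ^ 3 + C (3 / 2) * x ^ 3 * z + 6 * x ^ 2 * y * z
    + C (9 / 2) * x * y ^ 2 * z + C (1 / 2) * y ^ 3 * z + C (9 / 2) * x ^ 2 * z ^ 2
    + 6 * x * y * z ^ 2 + y ^ 2 * z ^ 2 + 3 * x * z ^ 3 + C (1 / 2) * y * z ^ 3
    - x ^ 2 * y * t - x * y ^ 2 * t - 3 * x ^ 2 * z * t - 4 * x * y * z * t
    - y ^ 2 * z * t - 3 * x * z ^ 2 * t - y * z ^ 2 * t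

/-- The surface of equation `F = 0` in `ℙ³` over `K`, for a form `F` in four variables:
the set of the points all of whose coordinate vectors are zeros of `F`. -/
def surface (F : MvPolynomial (Fin 4) K) : Set (ℙ K (Fin 4 → K)) :=
  {P | ∀ (v : Fin 4 → K) (hv : v ≠ 0), Projectivization.mk K v hv = P → eval v F = 0}

/-- The natural action of an invertible matrix on forms: `M · F = F (M⁻¹ · ᵗ(x, y, z, t))`. -/
noncomputable def act (M : GL (Fin 4) K) (F : MvPolynomial (Fin 4) K) :
    MvPolynomial (Fin 4) K :=
  bind₁ (fun i => ∑ j, C ((M⁻¹ : GL (Fin 4) K).val i j) * X j) F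

/-- The stabiliser `G_a` in `PGL(4, K)` of the surface `Q(a) = 0`, for the natural action of
`PGL(4, K)` on the subsets of `ℙ³` (a matrix acts on columns of homogeneous coordinates). -/
def G (a : K) : Subgroup PGL(4, K) :=
  MulAction.stabilizer PGL(4, K) (surface (Q a))

end QuarticMonoid

namespace QuarticMonoid

/-! ### The monoid form of Q(a), and forms vanishing at its K-points -/

section

/-! Write Q(a) = q₄ + t·q₃ with q₃ (`cubic`) and q₄ (`quartic`) forms in x, y, z. The surface is a
monoid: it has the triple point (0:0:0:1) with tangent cone q₃ = 0, and solving for t parametrises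
it rationally over K. So its K-points determine the form even when K is not algebraically closed: a
quartic form vanishing at all of them is divisible by Q(a) (`dvd_of_vanishing`), and preserving the
set of points is the same as preserving the form up to a scalar (`mk_mem_G_iff`).

Since q₃ is a smooth plane cubic, such a matrix fixes the triple point (`apex_fixed`) and acts on
the curve q₃ = 0 and on its intersection with q₄ = 0. On the curve, q₄ is a product of four lines up
to a constant, and the only flexes on these lines are the three on y = 0 (`y_eq_zero_of_flex`). They
are permuted, which gives a map to S₃. An element of its kernel is a scalar l on y = 0, and
invariance of q₃ makes its eigenvalue on the quotient equal to zl with z³ = 1, where z = 1 unless a²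
- a + 1 = 0. If z = 1 the matrix is scalar, because q₄ is not a multiple of q₃
(`Preserves.of_fixes_pt`).

A character of the block matrices extends z to the whole group, so G_a embeds in S₃ × Kˣ
(`exists_actionHom`). The explicit matrices show that the image is S₃, or S₃ × μ₃ when a² - a + 1 =
0. -/

/-- The cubic form of the tangent cone of `Q a` at `(0 : 0 : 0 : 1)`, as a function. -/
def cubic {R : Type*} [CommRing R] (a x y z : R) : R :=
  -2 * a * x ^ 2 * y - 2 * a * x * y ^ 2 + 2 * (2 * a - 1) * (a - 2) * x ^ 2 * z
    + 4 * (a ^ 2 - 3 * a + 1) * x * y * z - 2 * a * y ^ 2 * z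
    + 2 * (2 * a - 1) * (a - 2) * x * z ^ 2 - 2 * a * y * z ^ 2

/-- The part of `Q a` free of `t`, as a function. -/
def quartic {R : Type*} [CommRing R] (a x y z : R) : R :=
  2 * a * x ^ 3 * y + 4 * a * x ^ 2 * y ^ 2 + 2 * a * x * y ^ 3
    - (2 * a - 1) * (a - 2) * x ^ 3 * z
    - (5 * a ^ 2 - 17 * a + 5) * x ^ 2 * y * z
    - 3 * (a ^ 2 - 4 * a + 1) * x * y ^ 2 * z + a * y ^ 3 * z
    - 3 * (2 * a - 1) * (a - 2) * x ^ 2 * z ^ 2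
    - (7 * a ^ 2 - 19 * a + 7) * x * y * z ^ 2 + 2 * a * y ^ 2 * z ^ 2
    - 2 * (2 * a - 1) * (a - 2) * x * z ^ 3 + a * y * z ^ 3

/-- The form `Q a` as a function on coordinate vectors. -/
def form {R : Type*} [CommRing R] (a : R) (v : Fin 4 → R) : R :=
  quartic a (v 0) (v 1) (v 2) + v 3 * cubic a (v 0) (v 1) (v 2)

/-- On the cubic, the quartic part is a product of four linear forms. -/
lemma two_mul_quartic {R : Type*} [CommRing R] (a x y z : R) :
    4 * quartic a x y z = 2 * a * y * (x - z) * (x + y + 2 * z) * (2 * x + y + z)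
      - (2 * x + 3 * y + 4 * z) * cubic a x y z := by
  simp only [quartic, cubic]; ring

variable {K : Type*} [Field K]

lemma eval_Q (a : K) (v : Fin 4 → K) : eval v (Q a) = form a v := by
  simp [Q, form, quartic, cubic]; ring

lemma cubic_mul (a s x y z : K) : cubic a (s * x) (s * y) (s * z) = s ^ 3 * cubic a x y z := by
  simp only [cubic]; ring

lemma quartic_mul (a s x y z : K) :
    quartic a (s * x) (s * y) (s * z) = s ^ 4 * quartic a x y z := by
  simp only [quartic]; ring

lemma form_smul (a s : K) (v : Fin 4 → K) : form a (s • v) = s ^ 4 * form a v := by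
  simp only [form, Pi.smul_apply, smul_eq_mul, cubic_mul, quartic_mul]; ring

lemma map_quartic {R S : Type*} [CommRing R] [CommRing S] (φ : R →+* S) (a x y z : R) :
    φ (quartic a x y z) = quartic (φ a) (φ x) (φ y) (φ z) := by
  simp [quartic, map_ofNat]

lemma eval_act (M : GL (Fin 4) K) (F : MvPolynomial (Fin 4) K) (v : Fin 4 → K) :
    eval v (act M F) = eval (M⁻¹.val *ᵥ v) F := by
  rw [act, ← MvPolynomial.coe_aeval_eq_eval, ← MvPolynomial.coe_aeval_eq_eval, RingHom.coe_coe,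
    RingHom.coe_coe, aeval_bind₁]
  congr 2
  ext i
  simp [mulVec, dotProduct]

lemma isHomogeneous_Q [Infinite K] (a : K) : (Q a).IsHomogeneous 4 := by
  have h (c : K) (i j k l : Fin 4) : (C c * X i * X j * X k * X l).IsHomogeneous 4 :=
    ((((isHomogeneous_C _ _).mul (isHomogeneous_X _ _)).mul (isHomogeneous_X _ _)).mul
      (isHomogeneous_X _ _)).mul (isHomogeneous_X _ _)
  have e : Q a = C (2 * a) * X 0 * X 0 * X 0 * X 1 + C (4 * a) * X 0 * X 0 * X 1 * X 1
      + C (2 * a) * X 0 * X 1 * X 1 * X 1 - C ((2 * a - 1) * (a - 2)) * X 0 * X 0 * X 0 * X 2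
      - C (5 * a ^ 2 - 17 * a + 5) * X 0 * X 0 * X 1 * X 2
      - C (3 * (a ^ 2 - 4 * a + 1)) * X 0 * X 1 * X 1 * X 2 + C a * X 1 * X 1 * X 1 * X 2
      - C (3 * (2 * a - 1) * (a - 2)) * X 0 * X 0 * X 2 * X 2
      - C (7 * a ^ 2 - 19 * a + 7) * X 0 * X 1 * X 2 * X 2 + C (2 * a) * X 1 * X 1 * X 2 * X 2
      - C (2 * (2 * a - 1) * (a - 2)) * X 0 * X 2 * X 2 * X 2 + C a * X 1 * X 2 * X 2 * X 2
      - C (2 * a) * X 3 * X 0 * X 0 * X 1 - C (2 * a) * X 3 * X 0 * X 1 * X 1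
      + C (2 * (2 * a - 1) * (a - 2)) * X 3 * X 0 * X 0 * X 2
      + C (4 * (a ^ 2 - 3 * a + 1)) * X 3 * X 0 * X 1 * X 2 - C (2 * a) * X 3 * X 1 * X 1 * X 2
      + C (2 * (2 * a - 1) * (a - 2)) * X 3 * X 0 * X 2 * X 2
      - C (2 * a) * X 3 * X 1 * X 2 * X 2 := by
    apply MvPolynomial.funext
    intro v
    rw [eval_Q]
    simp only [eval_add, eval_mul, eval_sub, eval_C, eval_X, form, quartic, cubic]
    ring
  rw [e]
  refine IsHomogeneous.sub ?_ (h _ _ _ _ _)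
  refine IsHomogeneous.add ?_ (h _ _ _ _ _)
  refine IsHomogeneous.sub ?_ (h _ _ _ _ _)
  refine IsHomogeneous.add ?_ (h _ _ _ _ _)
  refine IsHomogeneous.add ?_ (h _ _ _ _ _)
  refine IsHomogeneous.sub ?_ (h _ _ _ _ _)
  refine IsHomogeneous.sub ?_ (h _ _ _ _ _)
  refine IsHomogeneous.add ?_ (h _ _ _ _ _)
  refine IsHomogeneous.sub ?_ (h _ _ _ _ _)
  refine IsHomogeneous.add ?_ (h _ _ _ _ _)
  refine IsHomogeneous.sub ?_ (h _ _ _ _ _)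
  refine IsHomogeneous.sub ?_ (h _ _ _ _ _)
  refine IsHomogeneous.add ?_ (h _ _ _ _ _)
  refine IsHomogeneous.sub ?_ (h _ _ _ _ _)
  refine IsHomogeneous.sub ?_ (h _ _ _ _ _)
  refine IsHomogeneous.sub ?_ (h _ _ _ _ _)
  refine IsHomogeneous.add ?_ (h _ _ _ _ _)
  refine IsHomogeneous.add ?_ (h _ _ _ _ _)
  exact h _ _ _ _ _

lemma isHomogeneous_act (M : GL (Fin 4) K) {F : MvPolynomial (Fin 4) K} {n : ℕ}
    (hF : F.IsHomogeneous n) : (act M F).IsHomogeneous n := by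
  have := hF.aeval (fun i => ∑ j, C ((M⁻¹ : GL (Fin 4) K).val i j) * X j) (n := 1)
    (fun i => IsHomogeneous.sum _ _ _ fun j _ => isHomogeneous_C_mul_X _ _)
  rw [one_mul] at this
  exact this

/-- Two substitutions congruent modulo an ideal give congruent results. -/
lemma dvd_bind₁_sub_bind₁ {σ τ : Type*} (P : MvPolynomial τ K) (f g : σ → MvPolynomial τ K)
    (h : ∀ i, P ∣ f i - g i) (F : MvPolynomial σ K) : P ∣ bind₁ f F - bind₁ g F := by
  have e : (Ideal.Quotient.mkₐ K (Ideal.span {P})).comp (bind₁ f) =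
      (Ideal.Quotient.mkₐ K (Ideal.span {P})).comp (bind₁ g) := by
    apply MvPolynomial.algHom_ext
    intro i
    rw [AlgHom.comp_apply, AlgHom.comp_apply, bind₁_X_right, bind₁_X_right]
    exact Ideal.Quotient.eq.2 (Ideal.mem_span_singleton.2 (h i))
  have := DFunLike.congr_fun e F
  exact Ideal.mem_span_singleton.1 (Ideal.Quotient.eq.1 this)

lemma excluded_ne_zero [CharZero K] {a : K} (ha : a ∉ ({-1, 0, 1 / 2, 1, 2} : Set K)) :
    a + 1 ≠ 0 ∧ a ≠ 0 ∧ 2 * a - 1 ≠ 0 ∧ a - 1 ≠ 0 ∧ a - 2 ≠ 0 := by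
  simp only [Set.mem_insert_iff, Set.mem_singleton_iff, not_or] at ha
  obtain ⟨h1, h2, h3, h4, h5⟩ := ha
  refine ⟨fun h => h1 (by linear_combination h), h2, fun h => h3 (by linear_combination h / 2),
    sub_ne_zero.2 h4, sub_ne_zero.2 h5⟩

/-- The cubic, as a polynomial. -/
noncomputable def cubicPoly (a : K) : MvPolynomial (Fin 4) K :=
  cubic (C a) (X 0) (X 1) (X 2)

lemma eval_cubicPoly (a : K) (v : Fin 4 → K) :
    eval v (cubicPoly a) = cubic a (v 0) (v 1) (v 2) := by
  simp [cubicPoly, cubic]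

variable [CharZero K]

/-- The linear form is irreducible, so it suffices that it does not divide the cubic. The point (x,
0, z) lies on the line, while the cubic takes there the nonzero value 2(2a - 1)(a - 2)xz(x + z). -/
lemma isRelPrime_linear_cubicPoly {a : K} (h1 : 2 * a - 1 ≠ 0) (h2 : a - 2 ≠ 0)
    (p q r x z : K) (hp : p ≠ 0 ∨ q ≠ 0 ∨ r ≠ 0) (h : p * x + r * z = 0) (hx : x ≠ 0) (hz : z ≠ 0)
    (hxz : x + z ≠ 0) :
    IsRelPrime (C p * X 0 + C q * X 1 + C r * X 2) (cubicPoly a) := by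
  have hom : (C p * X 0 + C q * X 1 + C r * X 2 : MvPolynomial (Fin 4) K).IsHomogeneous 1 :=
    ((isHomogeneous_C_mul_X _ _).add (isHomogeneous_C_mul_X _ _)).add (isHomogeneous_C_mul_X _ _)
  have hne : (C p * X 0 + C q * X 1 + C r * X 2 : MvPolynomial (Fin 4) K) ≠ 0 := by
    intro h0
    have h3 := congrArg (eval ![1, 0, 0, 0]) h0
    have h4 := congrArg (eval ![0, 1, 0, 0]) h0
    have h5 := congrArg (eval ![0, 0, 1, 0]) h0
    simp at h3 h4 h5
    simp_all
  have irr : Irreducible (C p * X 0 + C q * X 1 + C r * X 2 : MvPolynomial (Fin 4) K) := by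
    apply irreducible_of_totalDegree_eq_one (hom.totalDegree hne)
    intro u hu
    by_contra hu0
    apply hne
    have : u = 0 := by simpa using hu0
    subst this
    ext d
    simpa using hu d
  rw [irr.isRelPrime_iff_not_dvd]
  rintro ⟨g, hg⟩
  have := congrArg (eval ![x, 0, z, 0]) hg
  rw [eval_mul, eval_cubicPoly] at this
  simp [h, cubic] at this
  have h0 : 2 * ((2 * a - 1) * (a - 2) * x * z * (x + z)) = 0 := by linear_combination this
  simp [h1, h2, hx, hz, hxz] at h0

/-- Modulo the cubic, Q(a) is a nonzero constant times four linear forms, each of which is prime to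
the cubic. -/
lemma isRelPrime_Q_cubicPoly {a : K} (h0 : a ≠ 0) (h1 : 2 * a - 1 ≠ 0) (h2 : a - 2 ≠ 0) :
    IsRelPrime (Q a) (cubicPoly a) := by
  have e : Q a = C (a / 2) * ((C 0 * X 0 + C 1 * X 1 + C 0 * X 2) *
      (C 1 * X 0 + C 0 * X 1 + C (-1) * X 2) * (C 1 * X 0 + C 1 * X 1 + C 2 * X 2) *
      (C 2 * X 0 + C 1 * X 1 + C 1 * X 2)) +
      cubicPoly a * (X 3 - C (1 / 4) * (C 2 * X 0 + C 3 * X 1 + C 4 * X 2)) := by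
    apply MvPolynomial.funext
    intro v
    rw [eval_Q]
    simp only [eval_add, eval_mul, eval_sub, eval_cubicPoly, eval_C, eval_X, form]
    linear_combination (1 / 4 : K) * two_mul_quartic a (v 0) (v 1) (v 2)
  rw [e, IsRelPrime.add_mul_left_left_iff]
  have hu : IsUnit (C (a / 2) : MvPolynomial (Fin 4) K) := by
    apply IsUnit.map; simpa using h0
  rw [isRelPrime_mul_unit_left_left hu]
  refine ((IsRelPrime.mul_left ?_ ?_).mul_left ?_).mul_left ?_
  · exact isRelPrime_linear_cubicPoly h1 h2 _ _ _ 1 1 (by simp) (by simp) (by simp) (by simp)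
      (by norm_num)
  · exact isRelPrime_linear_cubicPoly h1 h2 _ _ _ 1 1 (by simp) (by simp) (by simp) (by simp)
      (by norm_num)
  · exact isRelPrime_linear_cubicPoly h1 h2 _ _ _ 2 (-1) (by simp) (by simp) (by simp) (by simp)
      (by norm_num)
  · exact isRelPrime_linear_cubicPoly h1 h2 _ _ _ 1 (-2) (by simp) (by simp) (by simp) (by simp)
      (by norm_num)

/-- A quartic form vanishing at all `K`-points of `Q a = 0` is a multiple of `Q a`. -/
lemma dvd_of_vanishing {a : K} (h0 : a ≠ 0) (h1 : 2 * a - 1 ≠ 0) (h2 : a - 2 ≠ 0)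
    {F : MvPolynomial (Fin 4) K} (hs : ∀ (s : K) (v : Fin 4 → K), eval (s • v) F = s ^ 4 * eval v F)
    (hF : ∀ v, form a v = 0 → eval v F = 0) : Q a ∣ F := by
  have key : Q a ∣ cubicPoly a ^ 4 * F := by
    -- By homogeneity of degree 4, scaling every variable by the cubic multiplies F by its fourth
    -- power.
    have e1 : cubicPoly a ^ 4 * F = bind₁ (fun i => cubicPoly a * X i) F := by
      apply MvPolynomial.funext
      intro v
      have : eval v (bind₁ (fun i => cubicPoly a * X i) F) = eval (eval v (cubicPoly a) • v) F := by
        rw [← MvPolynomial.coe_aeval_eq_eval, ← MvPolynomial.coe_aeval_eq_eval, RingHom.coe_coe,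
          RingHom.coe_coe, aeval_bind₁]
        congr 2
        ext i
        simp
      rw [this, hs]
      simp
    -- The rational parametrisation t = -q₄/q₃ with denominators cleared. F vanishes identically
    -- along it, and modulo Q(a) it agrees with the scaled variables, since q₃t + q₄ = Q(a).
    let w : Fin 4 → MvPolynomial (Fin 4) K := ![cubicPoly a * X 0, cubicPoly a * X 1,
      cubicPoly a * X 2, -(quartic (C a) (X 0) (X 1) (X 2))]
    have e2 : bind₁ w F = 0 := by
      apply MvPolynomial.funext
      intro v
      have : eval v (bind₁ w F) = eval (fun i => eval v (w i)) F := by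
        rw [← MvPolynomial.coe_aeval_eq_eval, ← MvPolynomial.coe_aeval_eq_eval, RingHom.coe_coe,
          RingHom.coe_coe, aeval_bind₁]
      rw [this, map_zero]
      apply hF
      simp [w, form, eval_cubicPoly, map_quartic, cubic_mul, quartic_mul]
      ring
    have := dvd_bind₁_sub_bind₁ (Q a) (fun i => cubicPoly a * X i) w ?_ F
    · rwa [e1, ← sub_zero (bind₁ _ F), ← e2]
    · intro i
      fin_cases i
      · simp [w]
      · simp [w]
      · simp [w]
      · refine dvd_of_eq ?_
        apply MvPolynomial.funext
        intro v
        rw [eval_Q]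
        simp [w, form, eval_cubicPoly, map_quartic]
        ring
  exact (isRelPrime_Q_cubicPoly h0 h1 h2).pow_right.dvd_of_dvd_mul_left key

end

/-! ### From the set of points to the form -/

section

variable {K : Type*} [Field K]

/-- The invertible matrix `M` preserves the form `Q a` up to a nonzero scalar. -/
def Preserves (a : K) (M : GL (Fin 4) K) : Prop :=
  ∃ c : K, c ≠ 0 ∧ ∀ v, form a (M.val *ᵥ v) = c * form a v

lemma mk_mem_surface_Q (a : K) {v : Fin 4 → K} (hv : v ≠ 0) :
    Projectivization.mk K v hv ∈ surface (Q a) ↔ form a v = 0 := by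
  constructor
  · intro h
    rw [← eval_Q]
    exact h v hv rfl
  · intro h w hw e
    obtain ⟨u, rfl⟩ := (Projectivization.mk_eq_mk_iff' K w v hw hv).1 e
    rw [eval_Q, form_smul, h, mul_zero]

lemma mulVec_inv_mulVec (M : GL (Fin 4) K) (v : Fin 4 → K) : M.val *ᵥ (M⁻¹.val *ᵥ v) = v := by
  rw [mulVec_mulVec, ← Units.val_mul, mul_inv_cancel]; simp

lemma inv_mulVec_mulVec (M : GL (Fin 4) K) (v : Fin 4 → K) : M⁻¹.val *ᵥ (M.val *ᵥ v) = v := by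
  rw [mulVec_mulVec, ← Units.val_mul, inv_mul_cancel]; simp

lemma act_Q_eq_smul_iff [Infinite K] (a : K) (M : GL (Fin 4) K) :
    (∃ c : K, c ≠ 0 ∧ act M (Q a) = c • Q a) ↔ Preserves a M := by
  constructor
  · rintro ⟨c, hc, h⟩
    refine ⟨c⁻¹, inv_ne_zero hc, fun v => ?_⟩
    have := congrArg (eval (M.val *ᵥ v)) h
    rw [eval_act, inv_mulVec_mulVec, smul_eval, eval_Q, eval_Q] at this
    rw [this, inv_mul_cancel_left₀ hc]
  · rintro ⟨c, hc, h⟩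
    refine ⟨c⁻¹, inv_ne_zero hc, ?_⟩
    apply MvPolynomial.funext
    intro v
    rw [eval_act, smul_eval, eval_Q, eval_Q, ← mulVec_inv_mulVec M v, h, mulVec_inv_mulVec,
      inv_mul_cancel_left₀ hc]

lemma mk_mem_G_iff_forall (a : K) (M : GL (Fin 4) K) :
    ProjGenLinGroup.mk M ∈ G a ↔ ∀ v, form a (M.val *ᵥ v) = 0 ↔ form a v = 0 := by
  rw [G, MulAction.mem_stabilizer_set]
  constructor
  · intro h v
    by_cases hv : v = 0
    · simp [hv]
    · have := h (Projectivization.mk K v hv)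
      rwa [Projectivization.PGL.mk_smul_mk, mk_mem_surface_Q, mk_mem_surface_Q] at this
  · intro h P
    induction P using Projectivization.ind with | _ v hv =>
    rw [Projectivization.PGL.mk_smul_mk, mk_mem_surface_Q, mk_mem_surface_Q]
    exact h v

lemma Q_ne_zero [CharZero K] {a : K} (h0 : a ≠ 0) : Q a ≠ 0 := by
  intro h
  have h1 := congrArg (eval ![1, 1, 0, 0]) h
  have h2 := congrArg (eval ![1, 1, 0, 1]) h
  rw [eval_Q, map_zero] at h1 h2
  simp [form, quartic, cubic] at h1 h2
  apply h0
  linear_combination h1 / 8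

lemma mk_mem_G_iff [CharZero K] {a : K} (h0 : a ≠ 0) (h1 : 2 * a - 1 ≠ 0) (h2 : a - 2 ≠ 0)
    (M : GL (Fin 4) K) : ProjGenLinGroup.mk M ∈ G a ↔ Preserves a M := by
  constructor
  · intro h
    rw [mk_mem_G_iff_forall] at h
    rw [← act_Q_eq_smul_iff]
    obtain ⟨H, hH⟩ : Q a ∣ act M (Q a) := by
      refine dvd_of_vanishing h0 h1 h2 (fun s v => ?_) (fun v hv => ?_)
      · rw [eval_act, eval_act, mulVec_smul, eval_Q, eval_Q, form_smul]
      · rw [eval_act, eval_Q, ← h, mulVec_inv_mulVec, hv]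
    have hne : act M (Q a) ≠ 0 := by
      intro h3
      apply Q_ne_zero h0
      apply MvPolynomial.funext
      intro v
      have := congrArg (eval (M.val *ᵥ v)) h3
      rwa [eval_act, inv_mulVec_mulVec] at this
    have hH0 : H ≠ 0 := by rintro rfl; exact hne (by simp [hH])
    -- Both forms have degree 4, so the quotient `H` is a constant.
    have hd := congrArg totalDegree hH
    rw [totalDegree_mul_of_isDomain (Q_ne_zero h0) hH0,
      (isHomogeneous_Q a).totalDegree (Q_ne_zero h0),
      (isHomogeneous_act M (isHomogeneous_Q a)).totalDegree hne] at hd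
    have hd' : H.totalDegree = 0 := by omega
    rw [totalDegree_eq_zero_iff_eq_C] at hd'
    refine ⟨H.coeff 0, fun h4 => hH0 (by rw [hd', h4, C_0]), ?_⟩
    rw [hH, smul_eq_C_mul, mul_comm, ← hd']
  · rintro ⟨c, hc, h⟩
    rw [mk_mem_G_iff_forall]
    intro v
    rw [h]
    simp [hc]

end

/-! ### Smoothness of the tangent cone and invariance of the triple point -/

section

variable {K : Type*} [Field K]

/-- The tangent cone cubic on coordinate vectors. -/
def cone (a : K) (v : Fin 4 → K) : K := cubic a (v 0) (v 1) (v 2)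

/-- The triple point of the surface. -/
def apex (K : Type*) [Field K] : Fin 4 → K := ![0, 0, 0, 1]

lemma form_add_smul_apex (a s : K) (v : Fin 4 → K) :
    form a (v + s • apex K) = form a v + s * cone a v := by
  simp [form, cone, apex]; ring

variable [CharZero K]

/-- The cubic is smooth: a point at which its gradient vanishes is zero. -/
lemma eq_zero_of_cubic_symm {a : K} (ha : a ∉ ({-1, 0, 1 / 2, 1, 2} : Set K)) {x y z : K}
    (h : ∀ u v w : K, cubic a (u + x) (v + y) (w + z) + cubic a (u - x) (v - y) (w - z)
      = 2 * cubic a u v w) : x = 0 ∧ y = 0 ∧ z = 0 := by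
  obtain ⟨n1, n2, n3, n4, n5⟩ := excluded_ne_zero ha
  -- For a cubic f, f(u + p) + f(u - p) - 2f(u) is twice the derivative of f at p in the direction
  -- u, so the basis vectors give the three partial derivatives.
  have hx := h 1 0 0
  have hy := h 0 1 0
  have hz := h 0 0 1
  simp only [cubic] at hx hy hz
  have e1 : (3 * (2 * x + z) + 3 * y) * (3 * (2 * a - 1) * (a - 2) * (z + y / 3)
      - 2 * (a ^ 2 - a + 1) * y) = 0 := by
    linear_combination (9 / 4) * hx
  have e2 : (3 * (x + 2 * z) + 3 * y) * (3 * (2 * a - 1) * (a - 2) * (x + y / 3)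
      - 2 * (a ^ 2 - a + 1) * y) = 0 := by
    linear_combination (9 / 4) * hz
  have e3 : (a + 1) ^ 2 * y ^ 2 = 3 * (a ^ 2 - a + 1) * ((x + y / 3) ^ 2
      + (x + y / 3) * (z + y / 3) + (z + y / 3) ^ 2) := by
    linear_combination (9 / 8) * hy - (3 / 8) * hx - (3 / 8) * hz
  -- With X = x + y/3 and Z = z + y/3 the cubic becomes 2kXZ(X + Z) - (4/3)jy(X² + XZ + Z²) +
  -- (4/27)(a + 1)²y³, where k = (2a - 1)(a - 2) and j = a² - a + 1. Its X- and Z-derivatives split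
  -- into linear factors.
  obtain ⟨X, hX⟩ : ∃ X, X = x + y / 3 := ⟨_, rfl⟩
  obtain ⟨Z, hZ⟩ : ∃ Z, Z = z + y / 3 := ⟨_, rfl⟩
  obtain rfl : x = X - y / 3 := by rw [hX]; ring
  obtain rfl : z = Z - y / 3 := by rw [hZ]; ring
  clear hX hZ hx hy hz h
  have hk : (2 * a - 1) * (a - 2) ≠ 0 := mul_ne_zero n3 n5
  -- The discriminant enters through 4(a² - a + 1)³ - ((a + 1)(2a - 1)(a - 2))² = 27a²(a - 1)².
  have key : 27 * (a * (a - 1)) ^ 2 * y ^ 2 = 0 := by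
    suffices h : 3 * ((2 * a - 1) * (a - 2)) ^ 2 * (X ^ 2 + X * Z + Z ^ 2)
        = 4 * (a ^ 2 - a + 1) ^ 2 * y ^ 2 ∨ y = 0 by
      rcases h with h | h
      · linear_combination (-((2 * a - 1) * (a - 2)) ^ 2) * e3 - (a ^ 2 - a + 1) * h
      · simp [h]
    rcases mul_eq_zero.1 e1 with f1 | f1 <;> rcases mul_eq_zero.1 e2 with f2 | f2
    · right
      have hX : X = 0 := by linear_combination (2 * f1 - f2) / 9
      have hZ : Z = 0 := by linear_combination (2 * f2 - f1) / 9
      have : (a + 1) ^ 2 * y ^ 2 = 0 := by rw [e3, hX, hZ]; ring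
      simpa [n1] using this
    · left
      have hZ : Z = -2 * X := by linear_combination f1 / 3
      have hy : 2 * (a ^ 2 - a + 1) * y = 3 * (2 * a - 1) * (a - 2) * X := by
        linear_combination -f2
      rw [hZ]
      linear_combination (-(2 * (a ^ 2 - a + 1) * y + 3 * (2 * a - 1) * (a - 2) * X)) * hy
    · left
      have hX : X = -2 * Z := by linear_combination f2 / 3
      have hy : 2 * (a ^ 2 - a + 1) * y = 3 * (2 * a - 1) * (a - 2) * Z := by
        linear_combination -f1
      rw [hX]
      linear_combination (-(2 * (a ^ 2 - a + 1) * y + 3 * (2 * a - 1) * (a - 2) * Z)) * hy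
    · left
      have hXZ : (2 * a - 1) * (a - 2) * (X - Z) = 0 := by linear_combination (f2 - f1) / 3
      obtain rfl : X = Z := by simpa [hk, sub_eq_zero] using hXZ
      have hy : 2 * (a ^ 2 - a + 1) * y = 3 * (2 * a - 1) * (a - 2) * X := by
        linear_combination -f2
      linear_combination (-(2 * (a ^ 2 - a + 1) * y + 3 * (2 * a - 1) * (a - 2) * X)) * hy
  have hy0 : y = 0 := by simpa [n2, n4] using key
  subst hy0
  have g1 : (2 * a - 1) * (a - 2) * ((2 * X + Z) * Z) = 0 := by linear_combination e1 / 9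
  have g2 : (2 * a - 1) * (a - 2) * ((X + 2 * Z) * X) = 0 := by linear_combination e2 / 9
  have g1 := (mul_eq_zero.1 g1).resolve_left hk
  have g2 := (mul_eq_zero.1 g2).resolve_left hk
  have hXZ : X = Z ∨ X = -Z := by
    rw [← sq_eq_sq_iff_eq_or_eq_neg]; linear_combination g2 - g1
  have hX : X = 0 := by
    rcases hXZ with rfl | rfl
    · simpa [show (2 * X + X) * X = 3 * X ^ 2 by ring] using g1
    · have : Z ^ 2 = 0 := by linear_combination -g1
      simpa using this
  have hZ : Z = 0 := by rcases hXZ with h | h <;> simpa [hX] using h.symm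
  simp [hX, hZ]

/-- Q(a) is affine along the direction of the triple point, hence also along its image p, so the
second difference in the direction p vanishes. The coefficient of t in this identity says that the
gradient of the smooth cubic vanishes at p. -/
lemma apex_fixed {a : K} (ha : a ∉ ({-1, 0, 1 / 2, 1, 2} : Set K)) {M : GL (Fin 4) K}
    (h : Preserves a M) : M.val 0 3 = 0 ∧ M.val 1 3 = 0 ∧ M.val 2 3 = 0 := by
  obtain ⟨c, hc, h⟩ := h
  have hM (i : Fin 4) : (M.val *ᵥ apex K) i = M.val i 3 := by
    simp [apex, mulVec, dotProduct, Fin.sum_univ_four]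
  have h1 (x : Fin 4 → K) : form a (x + M.val *ᵥ apex K) + form a (x - M.val *ᵥ apex K)
      = 2 * form a x := by
    have e := h (M⁻¹.val *ᵥ x)
    have e1 := h (M⁻¹.val *ᵥ x + (1 : K) • apex K)
    have e2 := h (M⁻¹.val *ᵥ x + (-1 : K) • apex K)
    rw [form_add_smul_apex, mulVec_add, mulVec_smul, mulVec_inv_mulVec] at e1 e2
    rw [mulVec_inv_mulVec] at e
    rw [one_smul] at e1
    rw [neg_one_smul, ← sub_eq_add_neg] at e2
    linear_combination e1 + e2 - 2 * e
  have h2 (x : Fin 4 → K) : cone a (x + M.val *ᵥ apex K) + cone a (x - M.val *ᵥ apex K)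
      = 2 * cone a x := by
    have e := h1 x
    have e1 := h1 (x + (1 : K) • apex K)
    rw [add_right_comm, add_sub_right_comm] at e1
    simp only [form_add_smul_apex] at e1
    linear_combination e1 - e
  apply eq_zero_of_cubic_symm ha
  intro u v w
  simpa [cone, hM] using h2 ![u, v, w, 0]

end

/-! ### Flexes of the tangent cone -/

section

variable {K : Type*} [Field K]

/-- The symmetric trilinear form attached to the cubic. -/
def polar (a : K) (u v w : Fin 4 → K) : K :=
  cone a (u + v + w) - cone a (u + v) - cone a (v + w) - cone a (u + w)
    + cone a u + cone a v + cone a w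

/-- The Hessian of the cubic is degenerate at `w`. -/
def HessianDegenerate (a : K) (w : Fin 4 → K) : Prop :=
  ∃ k : Fin 4 → K, (k 0 ≠ 0 ∨ k 1 ≠ 0 ∨ k 2 ≠ 0) ∧ ∀ u, polar a w k u = 0

/-- The Hessian determinant of the cubic. -/
lemma hessian_eq_zero {a : K} {w : Fin 4 → K} (h : HessianDegenerate a w) :
    32 * ((a ^ 2 - a + 1) ^ 2 * cone a w + 4 * (a * (a - 1)) ^ 2 * w 1 *
      (3 * w 0 ^ 2 + 3 * w 0 * w 2 + 3 * w 2 ^ 2 + 3 * w 1 * (w 0 + w 2) + w 1 ^ 2)) = 0 := by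
  obtain ⟨k, hk, h⟩ := h
  have h0 := h ![1, 0, 0, 0]
  have h1 := h ![0, 1, 0, 0]
  have h2 := h ![0, 0, 1, 0]
  set x := w 0 with hx
  set y := w 1 with hy
  set z := w 2 with hz
  obtain ⟨c, hc⟩ : ∃ c, c = (2 * a - 1) * (a - 2) := ⟨_, rfl⟩
  obtain ⟨e, he⟩ : ∃ e, e = a ^ 2 - 3 * a + 1 := ⟨_, rfl⟩
  obtain ⟨H00, e00⟩ : ∃ H, H = -4 * a * y + 4 * c * z := ⟨_, rfl⟩
  obtain ⟨H11, e11⟩ : ∃ H, H = -4 * a * x - 4 * a * z := ⟨_, rfl⟩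
  obtain ⟨H22, e22⟩ : ∃ H, H = 4 * c * x - 4 * a * y := ⟨_, rfl⟩
  obtain ⟨H01, e01⟩ : ∃ H, H = -4 * a * x - 4 * a * y + 4 * e * z := ⟨_, rfl⟩
  obtain ⟨H02, e02⟩ : ∃ H, H = 4 * c * x + 4 * e * y + 4 * c * z := ⟨_, rfl⟩
  obtain ⟨H12, e12⟩ : ∃ H, H = 4 * e * x - 4 * a * y - 4 * a * z := ⟨_, rfl⟩
  have r0 : H00 * k 0 + H01 * k 1 + H02 * k 2 = 0 := by
    rw [← h0, e00, e01, e02, hc, he]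
    simp [polar, cone, cubic, ← hx, ← hy, ← hz]; ring
  have r1 : H01 * k 0 + H11 * k 1 + H12 * k 2 = 0 := by
    rw [← h1, e11, e01, e12, he]
    simp [polar, cone, cubic, ← hx, ← hy, ← hz]; ring
  have r2 : H02 * k 0 + H12 * k 1 + H22 * k 2 = 0 := by
    rw [← h2, e22, e02, e12, hc, he]
    simp [polar, cone, cubic, ← hx, ← hy, ← hz]; ring
  obtain ⟨D, hD⟩ : ∃ D, D = H00 * (H11 * H22 - H12 ^ 2) - H01 * (H01 * H22 - H12 * H02)
    + H02 * (H01 * H12 - H11 * H02) := ⟨_, rfl⟩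
  have d0 : D * k 0 = 0 := by
    rw [hD]
    linear_combination (H11 * H22 - H12 ^ 2) * r0 - (H01 * H22 - H12 * H02) * r1
      + (H01 * H12 - H11 * H02) * r2
  have d1 : D * k 1 = 0 := by
    rw [hD]
    linear_combination -(H01 * H22 - H12 * H02) * r0 + (H00 * H22 - H02 ^ 2) * r1
      - (H00 * H12 - H01 * H02) * r2
  have d2 : D * k 2 = 0 := by
    rw [hD]
    linear_combination (H01 * H12 - H11 * H02) * r0 - (H00 * H12 - H01 * H02) * r1
      + (H00 * H11 - H01 ^ 2) * r2
  have hD0 : D = 0 := by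
    rcases hk with hk | hk | hk
    · simpa [hk] using d0
    · simpa [hk] using d1
    · simpa [hk] using d2
  rw [← hD0, hD, e00, e11, e22, e01, e02, e12, hc, he]
  simp only [cone, cubic, ← hx, ← hy, ← hz]
  ring

variable [CharZero K]

/-- The flexes of the cubic on the quartic lie on the line `y = 0`. -/
lemma y_eq_zero_of_flex {a : K} (ha : a ∉ ({-1, 0, 1 / 2, 1, 2} : Set K)) {w : Fin 4 → K}
    (h : HessianDegenerate a w) (h3 : cone a w = 0) (h4 : quartic a (w 0) (w 1) (w 2) = 0) :
    w 1 = 0 := by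
  obtain ⟨n1, n2, n3, n4, n5⟩ := excluded_ne_zero ha
  have e := hessian_eq_zero h
  rw [h3] at e
  have e4 := two_mul_quartic a (w 0) (w 1) (w 2)
  rw [h4, show cubic a (w 0) (w 1) (w 2) = 0 from h3] at e4
  simp only [cone, cubic] at h3
  generalize w 0 = x at *
  generalize w 1 = y at *
  generalize w 2 = z at *
  clear h h4
  by_contra hy
  simp only [mul_zero, zero_add, mul_eq_zero, pow_eq_zero_iff, n2, n4, hy, or_false, false_or,
    OfNat.ofNat_ne_zero, ne_eq, not_false_eq_true, sub_zero, zero_eq_mul] at e e4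
  -- Off y = 0 the Hessian leaves 3(X² + XZ + Z²) = 0, with X = x + y/3 and Z = z + y/3. The other
  -- three lines are X = Z, X + 2Z = 0 and 2X + Z = 0. Each meets this conic only at X = Z = 0, the
  -- point (1 : -3 : 1), which is off the cubic because a ≠ -1.
  suffices h : x = z ∧ y = -3 * z by
    obtain ⟨rfl, rfl⟩ := h
    have : (a + 1) ^ 2 * x ^ 3 = 0 := by linear_combination -h3 / 4
    simp_all
  rcases e4 with (h | h) | h
  · obtain rfl : x = z := sub_eq_zero.1 h
    have : (y + 3 * x) ^ 2 = 0 := by linear_combination e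
    exact ⟨rfl, by linear_combination pow_eq_zero_iff (two_ne_zero) |>.1 this⟩
  · obtain rfl : x = -y - 2 * z := by linear_combination h
    have : (y + 3 * z) ^ 2 = 0 := by linear_combination e
    have := pow_eq_zero_iff (two_ne_zero) |>.1 this
    exact ⟨by linear_combination -this, by linear_combination this⟩
  · obtain rfl : z = -y - 2 * x := by linear_combination h
    have : (y + 3 * x) ^ 2 = 0 := by linear_combination e
    have := pow_eq_zero_iff (two_ne_zero) |>.1 this
    exact ⟨by linear_combination this, by linear_combination -2 * this⟩

/-- The three flexes of the cubic on the line `y = 0`. -/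
def pt (K : Type*) [Field K] : Fin 3 → Fin 4 → K := ![![1, 0, 0, 0], ![0, 0, 1, 0], ![1, 0, -1, 0]]

omit [CharZero K] in
lemma cone_pt (a : K) (i : Fin 3) : cone a (pt K i) = 0 := by
  fin_cases i <;> simp [pt, cone, cubic]

omit [CharZero K] in
lemma form_pt (a : K) (i : Fin 3) : form a (pt K i) = 0 := by
  fin_cases i <;> simp [pt, form, quartic, cubic]
  ring

/-- The polar conic of a flex splits into two lines, the tangent and the harmonic polar. The witness
`k` is their common point. -/
lemma hessianDegenerate_pt {a : K} (ha : a ∉ ({-1, 0, 1 / 2, 1, 2} : Set K)) (i : Fin 3) :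
    HessianDegenerate a (pt K i) := by
  obtain ⟨n1, n2, n3, n4, n5⟩ := excluded_ne_zero ha
  fin_cases i
  · refine ⟨![a ^ 2 - a + 1 + (2 * a - 1) * (a - 2), -3 * (2 * a - 1) * (a - 2),
      -2 * (a ^ 2 - a + 1) + (2 * a - 1) * (a - 2), 0], by simp [n3, n5], fun u => ?_⟩
    simp [pt, polar, cone, cubic]; ring
  · refine ⟨![-2 * (a ^ 2 - a + 1) + (2 * a - 1) * (a - 2), -3 * (2 * a - 1) * (a - 2),
      a ^ 2 - a + 1 + (2 * a - 1) * (a - 2), 0], by simp [n3, n5], fun u => ?_⟩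
    simp [pt, polar, cone, cubic]; ring
  · refine ⟨![a ^ 2 - a + 1 + (2 * a - 1) * (a - 2), -3 * (2 * a - 1) * (a - 2),
      a ^ 2 - a + 1 + (2 * a - 1) * (a - 2), 0], by simp [n3, n5], fun u => ?_⟩
    simp [pt, polar, cone, cubic]; ring

end

/-! ### The permutation of the three flexes -/

section

variable {K : Type*} [Field K]

/-- The block shape shared by all matrices fixing the triple point and the line `y = 0` of the
tangent cone. -/
structure IsBlock (M : Matrix (Fin 4) (Fin 4) K) : Prop where
  h03 : M 0 3 = 0
  h13 : M 1 3 = 0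
  h23 : M 2 3 = 0
  h10 : M 1 0 = 0
  h12 : M 1 2 = 0

lemma IsBlock.mul {M N : Matrix (Fin 4) (Fin 4) K} (hM : IsBlock M) (hN : IsBlock N) :
    IsBlock (M * N) := by
  constructor <;>
    simp [Matrix.mul_apply, Fin.sum_univ_four, hM.h03, hM.h13, hM.h23, hM.h10, hM.h12,
      hN.h03, hN.h13, hN.h23, hN.h10, hN.h12]

lemma IsBlock.det_eq {M : Matrix (Fin 4) (Fin 4) K} (hM : IsBlock M) :
    M.det = M 1 1 * M 3 3 * (M 0 0 * M 2 2 - M 0 2 * M 2 0) := by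
  rw [det_succ_row_zero]
  simp [Fin.sum_univ_succ, det_fin_three, Fin.succAbove, submatrix_apply, hM.h03, hM.h13, hM.h23,
    hM.h10, hM.h12]
  ring

lemma IsBlock.ne_zero {M : GL (Fin 4) K} (hM : IsBlock M.val) :
    M.val 1 1 ≠ 0 ∧ M.val 3 3 ≠ 0 ∧ M.val 0 0 * M.val 2 2 - M.val 0 2 * M.val 2 0 ≠ 0 := by
  have h : M.val.det ≠ 0 := (M.val.isUnit_iff_isUnit_det.1 M.isUnit).ne_zero
  rw [hM.det_eq] at h
  simpa [and_assoc] using h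

lemma mulVec_apex_apply (M : Matrix (Fin 4) (Fin 4) K) (i : Fin 4) : (M *ᵥ apex K) i = M i 3 := by
  simp [apex, mulVec, dotProduct, Fin.sum_univ_four]

lemma mulVec_apex {M : Matrix (Fin 4) (Fin 4) K} (h0 : M 0 3 = 0) (h1 : M 1 3 = 0)
    (h2 : M 2 3 = 0) : M *ᵥ apex K = M 3 3 • apex K := by
  ext i
  rw [mulVec_apex_apply]
  fin_cases i <;> simp [apex, h0, h1, h2]

/-- `M` maps the line joining the triple point to the `i`-th flex to the `j`-th such line. -/
def Sends (M : Matrix (Fin 4) (Fin 4) K) (i j : Fin 3) : Prop :=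
  ∃ c d : K, c ≠ 0 ∧ M *ᵥ pt K i = c • pt K j + d • apex K

lemma Sends.mul {M N : Matrix (Fin 4) (Fin 4) K} {i j k : Fin 3} (hM : IsBlock M)
    (h : Sends M j k) (h' : Sends N i j) : Sends (M * N) i k := by
  obtain ⟨c, d, hc, h⟩ := h
  obtain ⟨c', d', hc', h'⟩ := h'
  have e := mulVec_apex hM.h03 hM.h13 hM.h23
  refine ⟨c' * c, c' * d + d' * M 3 3, mul_ne_zero hc' hc, ?_⟩
  rw [← mulVec_mulVec, h', mulVec_add, mulVec_smul, mulVec_smul, h, e]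
  module

lemma pt_independent {i j : Fin 3} {c d c' d' : K} (hc : c ≠ 0)
    (h : c • pt K i + d • apex K = c' • pt K j + d' • apex K) : i = j := by
  have h0 := congrFun h 0
  have h2 := congrFun h 2
  fin_cases i <;> fin_cases j <;> simp [pt, apex] at h0 h2 ⊢
  all_goals apply hc
  all_goals first | assumption | linear_combination h0 | linear_combination h2 |
    linear_combination h0 + h2

lemma Sends.right_unique {M : Matrix (Fin 4) (Fin 4) K} {i j k : Fin 3} (h : Sends M i j)
    (h' : Sends M i k) : j = k := by
  obtain ⟨c, d, hc, h⟩ := h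
  obtain ⟨c', d', hc', h'⟩ := h'
  exact pt_independent hc (h.symm.trans h')

lemma Sends.left_unique {M : GL (Fin 4) K} {i j k : Fin 3} (hM : IsBlock M.val)
    (h : Sends M.val i k) (h' : Sends M.val j k) : i = j := by
  obtain ⟨c, d, hc, h⟩ := h
  obtain ⟨c', d', hc', h'⟩ := h'
  have h3 := hM.ne_zero.2.1
  have e := mulVec_apex hM.h03 hM.h13 hM.h23
  refine pt_independent (c := c') (d := c * d' / M.val 3 3) (c' := c) (d' := c' * d / M.val 3 3)
    hc' ?_
  have : M.val *ᵥ (c' • pt K i + (c * d' / M.val 3 3) • apex K) =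
      M.val *ᵥ (c • pt K j + (c' * d / M.val 3 3) • apex K) := by
    rw [mulVec_add, mulVec_add, mulVec_smul, mulVec_smul, mulVec_smul, mulVec_smul, e, h, h',
      smul_smul, smul_smul, div_mul_cancel₀ _ h3, div_mul_cancel₀ _ h3]
    module
  have := congrArg (M⁻¹.val *ᵥ ·) this
  simpa only [inv_mulVec_mulVec] using this

variable [CharZero K]

section

variable {a : K} (ha : a ∉ ({-1, 0, 1 / 2, 1, 2} : Set K)) {M : GL (Fin 4) K}

include ha

/-- Compare the coefficients of the direction of the triple point, which `M` multiplies by its last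
diagonal entry. -/
lemma Preserves.cone_mulVec (h : Preserves a M) :
    ∃ c : K, c ≠ 0 ∧ (∀ v, form a (M.val *ᵥ v) = c * form a v) ∧
      ∀ v, M.val 3 3 * cone a (M.val *ᵥ v) = c * cone a v := by
  obtain ⟨e0, e1, e2⟩ := apex_fixed ha h
  obtain ⟨c, hc, h⟩ := h
  refine ⟨c, hc, h, fun v => ?_⟩
  have e := mulVec_apex e0 e1 e2
  have h1 := h (v + (1 : K) • apex K)
  rw [form_add_smul_apex, mulVec_add, mulVec_smul, e, one_smul, form_add_smul_apex] at h1
  linear_combination h1 - h v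

/-- Vanishing of the cubic and of the quartic, and degeneracy of the Hessian, are all transported by
`M`, so the image is again a flex on the quartic. -/
lemma Preserves.flex (h : Preserves a M) (i : Fin 3) :
    (M.val *ᵥ pt K i) 1 = 0 ∧ cone a (M.val *ᵥ pt K i) = 0 ∧
      ((M.val *ᵥ pt K i) 0 ≠ 0 ∨ (M.val *ᵥ pt K i) 2 ≠ 0) := by
  obtain ⟨e0, e1, e2⟩ := apex_fixed ha h
  obtain ⟨c, hc, hf, hg⟩ := h.cone_mulVec ha
  have e := mulVec_apex e0 e1 e2
  have hap : apex K ≠ 0 := fun h => by simpa [apex] using congrFun h 3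
  have h33 : M.val 3 3 ≠ 0 := by
    intro h3
    have := inv_mulVec_mulVec M (apex K)
    rw [e, h3, zero_smul, mulVec_zero] at this
    exact hap this.symm
  have hk (k : Fin 4 → K) (hk : k 0 ≠ 0 ∨ k 1 ≠ 0 ∨ k 2 ≠ 0) :
      (M.val *ᵥ k) 0 ≠ 0 ∨ (M.val *ᵥ k) 1 ≠ 0 ∨ (M.val *ᵥ k) 2 ≠ 0 := by
    by_contra! h0
    have h1 : M.val *ᵥ k = M.val *ᵥ (((M.val *ᵥ k) 3 / M.val 3 3) • apex K) := by
      rw [mulVec_smul, e, smul_smul, div_mul_cancel₀ _ h33]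
      ext i; fin_cases i <;> simp [apex, h0]
    have h2 := congrArg (M⁻¹.val *ᵥ ·) h1
    simp only [inv_mulVec_mulVec] at h2
    rw [h2] at hk
    simp [apex] at hk
  have h3 : cone a (M.val *ᵥ pt K i) = 0 := by
    have := hg (pt K i)
    rw [cone_pt, mul_zero] at this
    exact (mul_eq_zero.1 this).resolve_left h33
  have h4 : quartic a ((M.val *ᵥ pt K i) 0) ((M.val *ᵥ pt K i) 1) ((M.val *ᵥ pt K i) 2) = 0 := by
    have := hf (pt K i)
    rwa [form_pt, mul_zero, form, show cubic a _ _ _ = 0 from h3, mul_zero, add_zero] at this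
  have hess : HessianDegenerate a (M.val *ᵥ pt K i) := by
    obtain ⟨k, hk0, h5⟩ := hessianDegenerate_pt ha i
    refine ⟨M.val *ᵥ k, hk k hk0, fun u => ?_⟩
    have h6 : M.val 3 3 * polar a (M.val *ᵥ pt K i) (M.val *ᵥ k) (M.val *ᵥ (M⁻¹.val *ᵥ u)) =
        c * polar a (pt K i) k (M⁻¹.val *ᵥ u) := by
      simp only [polar, ← mulVec_add, mul_add, mul_sub, hg]
    rw [h5, mulVec_inv_mulVec, mul_zero] at h6
    exact (mul_eq_zero.1 h6).resolve_left h33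
  have h1 := y_eq_zero_of_flex ha hess h3 h4
  refine ⟨h1, h3, ?_⟩
  have := hk (pt K i) (by fin_cases i <;> simp [pt])
  simpa [h1] using this

lemma Preserves.isBlock (h : Preserves a M) : IsBlock M.val := by
  obtain ⟨e0, e1, e2⟩ := apex_fixed ha h
  refine ⟨e0, e1, e2, ?_, ?_⟩
  · simpa [pt, mulVec, dotProduct, Fin.sum_univ_four] using (h.flex ha 0).1
  · simpa [pt, mulVec, dotProduct, Fin.sum_univ_four] using (h.flex ha 1).1

lemma Preserves.exists_sends (h : Preserves a M) (i : Fin 3) : ∃ j, Sends M.val i j := by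
  obtain ⟨n1, n2, n3, n4, n5⟩ := excluded_ne_zero ha
  obtain ⟨hy, h3, hne⟩ := h.flex ha i
  unfold Sends
  generalize M.val *ᵥ pt K i = w at *
  -- On y = 0 the cubic is a nonzero multiple of xz(x + z), whose zeros are exactly the three
  -- flexes.
  have e : 2 * ((2 * a - 1) * (a - 2)) * (w 0 * w 2 * (w 0 + w 2)) = 0 := by
    rw [← h3, cone, cubic, hy]; ring
  simp only [mul_eq_zero, OfNat.ofNat_ne_zero, n3, n5, false_or] at e
  rcases e with (e | e) | e
  · refine ⟨1, w 2, w 3, by simpa [e] using hne, ?_⟩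
    ext i; fin_cases i <;> simp [pt, apex, e, hy]
  · refine ⟨0, w 0, w 3, by simpa [e] using hne, ?_⟩
    ext i; fin_cases i <;> simp [pt, apex, e, hy]
  · have e' : w 2 = -w 0 := by linear_combination e
    refine ⟨2, w 0, w 3, by simpa [e'] using hne, ?_⟩
    ext i; fin_cases i <;> simp [pt, apex, e', hy]

lemma Preserves.exists_perm (h : Preserves a M) :
    ∃ σ : Equiv.Perm (Fin 3), ∀ i, Sends M.val i (σ i) := by
  choose s hs using h.exists_sends ha
  have inj : Function.Injective s := fun i j hij =>
    Sends.left_unique (h.isBlock ha) (hs i) (hij ▸ hs j)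
  exact ⟨Equiv.ofBijective s (Finite.injective_iff_bijective.1 inj), hs⟩

end

end

/-! ### The kernel: matrices fixing the three flexes -/

section

variable {K : Type*} [Field K] [CharZero K]

/-- A stabilising matrix which fixes the three flexes acts on the tangent cone by a third root of
unity `z`, and it is scalar if `z = 1`. -/
lemma Preserves.of_fixes_pt {a : K} (ha : a ∉ ({-1, 0, 1 / 2, 1, 2} : Set K)) {M : GL (Fin 4) K}
    (h : Preserves a M) (hs : ∀ i, Sends M.val i i) {z : K}
    (hz : M.val 1 1 ^ 4 = z * (M.val 0 0 * M.val 2 2 - M.val 0 2 * M.val 2 0) ^ 2) :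
    z ^ 3 = 1 ∧ (a ^ 2 - a + 1 ≠ 0 → z = 1) ∧ (z = 1 → ProjGenLinGroup.mk M = 1) := by
  obtain ⟨n1, n2, n3, n4, n5⟩ := excluded_ne_zero ha
  have hb := h.isBlock ha
  obtain ⟨c, hc, hf, hg⟩ := h.cone_mulVec ha
  obtain ⟨b11, b33, bD⟩ := hb.ne_zero
  have h20 : M.val 2 0 = 0 := by
    obtain ⟨c, d, -, h⟩ := hs 0
    simpa [pt, apex, mulVec, dotProduct, Fin.sum_univ_four] using congrFun h 2
  have h02 : M.val 0 2 = 0 := by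
    obtain ⟨c, d, -, h⟩ := hs 1
    simpa [pt, apex, mulVec, dotProduct, Fin.sum_univ_four] using congrFun h 0
  have h22 : M.val 2 2 = M.val 0 0 := by
    obtain ⟨c, d, -, h⟩ := hs 2
    have e0 := congrFun h 0
    have e2 := congrFun h 2
    simp [pt, apex, mulVec, dotProduct, Fin.sum_univ_four, h20, h02] at e0 e2
    rw [e0, e2]
  have hv (x y z t : K) : M.val *ᵥ ![x, y, z, t] = ![M.val 0 0 * x + M.val 0 1 * y, M.val 1 1 * y,
      M.val 0 0 * z + M.val 2 1 * y,
      M.val 3 0 * x + M.val 3 1 * y + M.val 3 2 * z + M.val 3 3 * t] := by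
    ext i
    fin_cases i <;>
      simp [mulVec, dotProduct, Fin.sum_univ_four, hb.h03, hb.h13, hb.h23, hb.h10, hb.h12, h20, h02,
        h22]
    ring
  have hMe (u : Kˣ) (hu : M.val = u.val • 1) : ProjGenLinGroup.mk M = 1 := by
    rw [show M = GeneralLinearGroup.scalar (Fin 4) u from Units.ext (by
      rw [hu, smul_one_eq_diagonal]; rfl)]
    exact ProjGenLinGroup.mk_scalar u
  have hMent : M.val = !![M.val 0 0, M.val 0 1, 0, 0; 0, M.val 1 1, 0, 0; 0, M.val 2 1, M.val 0 0, 0;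
      M.val 3 0, M.val 3 1, M.val 3 2, M.val 3 3] := by
    ext i j
    fin_cases i <;> fin_cases j <;>
      simp [hb.h03, hb.h13, hb.h23, hb.h10, hb.h12, h20, h02, h22]
  rw [h22, h02, h20] at hz bD
  have hl : M.val 0 0 ≠ 0 := by
    intro h; simp [h] at bD
  have hg' (x y z : K) := hg ![x, y, z, 0]
  have hf' (x y z : K) := hf ![x, y, z, 0]
  simp only [hv] at hg' hf'
  simp only [cone, form] at hg' hf'
  simp at hg' hf'
  generalize M.val 0 0 = l at *
  generalize M.val 0 1 = b at *
  generalize M.val 1 1 = d at *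
  generalize M.val 2 1 = e at *
  generalize M.val 3 0 = l0 at *
  generalize M.val 3 1 = l1 at *
  generalize M.val 3 2 = l2 at *
  generalize M.val 3 3 = m at *
  have hk : (2 * a - 1) * (a - 2) ≠ 0 := mul_ne_zero n3 n5
  -- Restrict the cubic to y = 0, where `M` acts as the scalar `l`.
  have hcm : c = m * l ^ 3 := by
    have := hg' 1 0 1
    simp only [cubic] at this
    have h4 : (2 * a - 1) * (a - 2) * (c - m * l ^ 3) = 0 := by linear_combination -this / 4
    linear_combination (mul_eq_zero.1 h4).resolve_left hk
  have hg2 (x y z : K) : cubic a (l * x + b * y) (d * y) (l * z + e * y)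
      = l ^ 3 * cubic a x y z := by
    apply mul_left_cancel₀ b33
    rw [hg', hcm, mul_assoc]
  have hl2 : 2 * l ^ 2 ≠ 0 := by simp [hl]
  have g010 := hg2 0 1 0
  -- Coefficient of x²y in the invariance of the cubic. The next two relations are the coefficients
  -- of yz² and xyz.
  have he : (2 * a - 1) * (a - 2) * e = a * (d - l) := by
    apply mul_left_cancel₀ hl2
    have e1 := hg2 1 1 0
    have e2 := hg2 1 (-1) 0
    simp only [cubic] at e1 e2 g010
    linear_combination (e1 - e2) / 2 - g010
  have hbb : (2 * a - 1) * (a - 2) * b = a * (d - l) := by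
    apply mul_left_cancel₀ hl2
    have e1 := hg2 0 1 1
    have e2 := hg2 0 (-1) 1
    simp only [cubic] at e1 e2 g010
    linear_combination (e1 - e2) / 2 - g010
  have hbe : (2 * a - 1) * (a - 2) * (b + e) = (a ^ 2 - 3 * a + 1) * (l - d) := by
    apply mul_left_cancel₀ hl2
    have e1 := hg2 1 1 1
    have e2 := hg2 1 (-1) 1
    have e3 := hg2 1 1 0
    have e4 := hg2 1 (-1) 0
    have e5 := hg2 0 1 1
    have e6 := hg2 0 (-1) 1
    simp only [cubic] at e1 e2 e3 e4 e5 e6 g010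
    linear_combination (e1 - e2 - (e3 - e4) - (e5 - e6)) / 4 + g010 / 2
  have hj : (a ^ 2 - a + 1) * (d - l) = 0 := by linear_combination hbe - hbb - he
  obtain rfl : b = e := mul_left_cancel₀ hk (hbb.trans he.symm)
  have hz1 : d = l → z = 1 := by
    rintro rfl
    have : d ^ 4 * (z - 1) = 0 := by linear_combination -hz
    simpa [hl, sub_eq_zero] using this
  -- If d ≠ l then a² - a + 1 = 0, and the coefficient of y³ gives d³ = l³.
  have hd3 : d ^ 3 = l ^ 3 := by
    rcases eq_or_ne d l with rfl | hne
    · rfl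
    · have hj : a ^ 2 - a + 1 = 0 := (mul_eq_zero.1 hj).resolve_right (sub_ne_zero.2 hne)
      have hb3 : 3 * b = l - d := by
        apply mul_left_cancel₀ n2
        linear_combination -hbb + 2 * b * hj
      simp only [cubic] at g010
      have h3 : a * ((l - d) * (3 * b * b + 3 * b * d + d ^ 2)) = 0 := by
        rw [← hb3]
        linear_combination (-3 / 4) * g010 + (6 * b ^ 3 + 3 * b ^ 2 * d) * hj
      have h4 := (mul_eq_zero.1 h3).resolve_left n2
      have h5 : 3 * b * b + 3 * b * d + d ^ 2 = (l ^ 2 + l * d + d ^ 2) / 3 := by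
        linear_combination (b + d + (l - d) / 3) * hb3
      rw [h5] at h4
      linear_combination -3 * h4
  have hzd : d = z * l := by
    have : l ^ 3 * (d - z * l) = 0 := by linear_combination hz - d * hd3
    simpa [hl, sub_eq_zero] using this
  refine ⟨?_, ?_, ?_⟩
  · have : l ^ 3 * (z ^ 3 - 1) = 0 := by rw [hzd] at hd3; linear_combination hd3
    simpa [hl, sub_eq_zero] using this
  · intro hne
    exact hz1 (by simpa [hne, sub_eq_zero] using hj)
  · rintro rfl
    obtain rfl : d = l := by simpa using hzd
    have hb0 : b = 0 := by simpa [n3, n5] using hbb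
    subst hb0
    -- Now `M` is the scalar `d` on x, y, z, and only its last row is unknown. Four values of this
    -- identity force d = m and l0 = l1 = l2 = 0: the quartic is not a multiple of the cubic.
    have hq (x y z : K) : (d - m) * quartic a x y z + (l0 * x + l1 * y + l2 * z) * cubic a x y z
        = 0 := by
      have := hf' x y z
      simp only [zero_mul, add_zero, cubic_mul, quartic_mul, hcm] at this
      apply mul_left_cancel₀ (pow_ne_zero 3 hl)
      linear_combination this
    have q1 := hq 1 0 1
    have q2 := hq 2 0 1
    have q3 := hq 1 1 0
    have q4 := hq 2 1 0
    simp only [quartic, cubic] at q1 q2 q3 q4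
    have r1 : 2 * (l0 + l2) = 3 * (d - m) := by
      apply mul_left_cancel₀ hk; linear_combination q1 / 2
    have r2 : 2 * l0 + l2 = 2 * (d - m) := by
      apply mul_left_cancel₀ hk; linear_combination q2 / 12
    have r3 : l0 + l1 = 2 * (d - m) := by
      apply mul_left_cancel₀ n2; linear_combination -q3 / 4
    have r4 : 2 * l0 + l1 = 3 * (d - m) := by
      apply mul_left_cancel₀ n2; linear_combination -q4 / 12
    have hn : d - m = 0 := by linear_combination 2 * ((r2 - r1 / 2) - (r4 - r3))
    rw [hn] at r1 r2 r3 r4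
    have s0 : l0 = 0 := by linear_combination r4 - r3
    have s1 : l1 = 0 := by linear_combination r3 - s0
    have s2 : l2 = 0 := by linear_combination r2 - 2 * s0
    apply hMe (Units.mk0 d hl)
    rw [hMent, s0, s1, s2, ← sub_eq_zero.1 hn]
    ext i j
    fin_cases i <;> fin_cases j <;> simp

end

/-! ### The embedding in S₃ × Kˣ and the generators -/

section

variable {K : Type*} [Field K]

/-- `M` permutes the flexes by `σ`, and `z` is the value at `M` of the character of the group of
block matrices which is the fourth power of the eigenvalue on the quotient by `y = 0`, divided by
the square of the determinant on `y = 0`. -/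
structure ActsBy (M : GL (Fin 4) K) (σ : Equiv.Perm (Fin 3)) (z : Kˣ) : Prop where
  isBlock : IsBlock M.val
  sends : ∀ i, Sends M.val i (σ i)
  -- Numerator and denominator both have degree 4, so the quotient descends to PGL. Without the
  -- extra squaring the value at `matB` would be -1. On the kernel the fourth power of the
  -- eigenvalue ratio is the ratio itself, a cube root of unity.
  char : M.val 1 1 ^ 4 = z * (M.val 0 0 * M.val 2 2 - M.val 0 2 * M.val 2 0) ^ 2

lemma ActsBy.mul {M N : GL (Fin 4) K} {σ τ : Equiv.Perm (Fin 3)} {z w : Kˣ} (hM : ActsBy M σ z)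
    (hN : ActsBy N τ w) : ActsBy (M * N) (σ * τ) (z * w) := by
  refine ⟨hM.isBlock.mul hN.isBlock, fun i => (hM.sends (τ i)).mul hM.isBlock (hN.sends i), ?_⟩
  have h := hM.isBlock
  have h' := hN.isBlock
  have e11 : (M * N).val 1 1 = M.val 1 1 * N.val 1 1 := by
    simp [Matrix.mul_apply, Fin.sum_univ_four, h.h10, h.h12, h.h13]
  have eD : (M * N).val 0 0 * (M * N).val 2 2 - (M * N).val 0 2 * (M * N).val 2 0 =
      (M.val 0 0 * M.val 2 2 - M.val 0 2 * M.val 2 0) *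
        (N.val 0 0 * N.val 2 2 - N.val 0 2 * N.val 2 0) := by
    simp [Matrix.mul_apply, Fin.sum_univ_four, h.h03, h.h23, h'.h10, h'.h12]
    ring
  rw [e11, eD, mul_pow, hM.char, hN.char, Units.val_mul]
  ring

lemma actsBy_scalar (u : Kˣ) : ActsBy (GeneralLinearGroup.scalar (Fin 4) u) 1 1 := by
  refine ⟨⟨?_, ?_, ?_, ?_, ?_⟩, fun i => ⟨u, 0, u.ne_zero, ?_⟩, ?_⟩
  case refine_6 => ext j; simp [GeneralLinearGroup.scalar, mulVec_diagonal]
  all_goals simp [GeneralLinearGroup.scalar]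
  ring

lemma ActsBy.unique {M N : GL (Fin 4) K} {σ τ : Equiv.Perm (Fin 3)} {z w : Kˣ} (hM : ActsBy M σ z)
    (hN : ActsBy N τ w) (h : ProjGenLinGroup.mk M = ProjGenLinGroup.mk N) : (σ, z) = (τ, w) := by
  obtain ⟨u, rfl⟩ := ProjGenLinGroup.mk_eq_mk_iff.1 h
  have hM' := hM.mul (actsBy_scalar u)
  rw [mul_one, mul_one] at hM'
  have h1 : σ = τ := Equiv.ext fun i => (hM'.sends i).right_unique (hN.sends i)
  have h2 : z = w := by
    apply Units.ext
    exact mul_right_cancel₀ (pow_ne_zero 2 hN.isBlock.ne_zero.2.2)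
      (hM'.char.symm.trans hN.char)
  rw [h1, h2]

variable [CharZero K]

lemma Preserves.exists_actsBy {a : K} (ha : a ∉ ({-1, 0, 1 / 2, 1, 2} : Set K))
    {M : GL (Fin 4) K} (h : Preserves a M) : ∃ σ z, ActsBy M σ z := by
  obtain ⟨σ, hσ⟩ := h.exists_perm ha
  have hb := h.isBlock ha
  obtain ⟨h1, -, h2⟩ := hb.ne_zero
  refine ⟨σ, Units.mk0 _ (div_ne_zero (pow_ne_zero 4 h1) (pow_ne_zero 2 h2)), hb, hσ, ?_⟩
  rw [Units.val_mk0, div_mul_cancel₀ _ (pow_ne_zero 2 h2)]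

lemma preserves_of_mem {a : K} (ha : a ∉ ({-1, 0, 1 / 2, 1, 2} : Set K)) {M : GL (Fin 4) K}
    (h : ProjGenLinGroup.mk M ∈ G a) : Preserves a M := by
  obtain ⟨n1, n2, n3, n4, n5⟩ := excluded_ne_zero ha
  exact (mk_mem_G_iff n2 n3 n5 M).1 h

/-- The action of the stabiliser on the flexes, together with the character. -/
lemma exists_actionHom {a : K} (ha : a ∉ ({-1, 0, 1 / 2, 1, 2} : Set K)) :
    ∃ φ : G a →* Equiv.Perm (Fin 3) × Kˣ,
      (∀ (M : GL (Fin 4) K) (hM : ProjGenLinGroup.mk M ∈ G a) (σ : Equiv.Perm (Fin 3)) (z : Kˣ),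
        ActsBy M σ z → φ ⟨ProjGenLinGroup.mk M, hM⟩ = (σ, z)) ∧
      ∀ g, (φ g).1 = 1 → (φ g).2 ^ 3 = 1 ∧ (a ^ 2 - a + 1 ≠ 0 → (φ g).2 = 1) ∧
        ((φ g).2 = 1 → g = 1) := by
  choose rep hrep using fun g : G a => ProjGenLinGroup.mk_surjective g.1
  have hpres (g : G a) : Preserves a (rep g) := preserves_of_mem ha (by rw [hrep]; exact g.2)
  choose σ z hσz using fun g : G a => (hpres g).exists_actsBy ha
  -- Independence of the chosen representative, which also yields multiplicativity.
  have key (g : G a) (M : GL (Fin 4) K) (hM : ProjGenLinGroup.mk M = g.1) (τ : Equiv.Perm (Fin 3))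
      (w : Kˣ) (h : ActsBy M τ w) : (σ g, z g) = (τ, w) :=
    (hσz g).unique h (by rw [hrep, hM])
  refine ⟨MonoidHom.mk' (fun g => (σ g, z g)) fun g h => ?_, fun M hM τ w h => key _ M rfl τ w h,
    fun g hg => ?_⟩
  · exact key (g * h) (rep g * rep h) (by rw [map_mul, hrep, hrep]; rfl) _ _ ((hσz g).mul (hσz h))
  · simp only [MonoidHom.mk'_apply] at hg ⊢
    have h := hσz g
    obtain ⟨h1, h2, h3⟩ := (hpres g).of_fixes_pt ha (z := z g)
      (fun i => by simpa [hg] using h.sends i) h.char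
    refine ⟨by ext; simpa using h1, fun hj => by ext; simpa using h2 hj, fun hz => ?_⟩
    have := h3 (by simp [hz])
    rw [hrep] at this
    exact Subtype.ext this

lemma perm_fin_three_mem {H : Subgroup (Equiv.Perm (Fin 3))} (h1 : Equiv.swap 0 1 ∈ H)
    (h2 : Equiv.swap 1 2 ∈ H) (σ : Equiv.Perm (Fin 3)) : σ ∈ H := by
  have h : ∀ σ : Equiv.Perm (Fin 3), σ = 1 ∨ σ = Equiv.swap 0 1 ∨ σ = Equiv.swap 1 2 ∨
      σ = Equiv.swap 0 1 * Equiv.swap 1 2 ∨ σ = Equiv.swap 1 2 * Equiv.swap 0 1 ∨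
      σ = Equiv.swap 0 1 * Equiv.swap 1 2 * Equiv.swap 0 1 := by decide
  rcases h σ with rfl | rfl | rfl | rfl | rfl | rfl
  · exact H.one_mem
  · exact h1
  · exact h2
  · exact H.mul_mem h1 h2
  · exact H.mul_mem h2 h1
  · exact H.mul_mem (H.mul_mem h1 h2) h1

/-- The first generator. -/
def matA (K : Type*) [Field K] : Matrix (Fin 4) (Fin 4) K :=
  !![2, 2, 2, 0; 0, -2, 0, 0; -2, 0, 0, 0; 0, 1, 3, -2]

/-- The second generator. -/
def matB (K : Type*) [Field K] : Matrix (Fin 4) (Fin 4) K :=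
  !![2, 2, 2, 0; 0, -2, 0, 0; 0, 0, -2, 0; 0, -2, -3, 2]

/-- The additional generator for `a ^ 2 - a + 1 = 0`. -/
def matC (a : K) : Matrix (Fin 4) (Fin 4) K :=
  !![0, 2 * a - 2, 2 * a - 4, 0; 0, -4 * a + 2, 0, 0; 2 * a - 4, 2 * a - 2, 0, 0;
    -3, -3 * a, -3 * a, 4 * a - 2]

omit [CharZero K] in
lemma isBlock_matA : IsBlock (matA K) := by constructor <;> simp [matA]

omit [CharZero K] in
lemma isBlock_matB : IsBlock (matB K) := by constructor <;> simp [matB]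

omit [CharZero K] in
lemma isBlock_matC (a : K) : IsBlock (matC a) := by constructor <;> simp [matC]

lemma det_matA_ne_zero : (matA K).det ≠ 0 := by
  rw [isBlock_matA.det_eq]; simp [matA]

lemma det_matB_ne_zero : (matB K).det ≠ 0 := by
  rw [isBlock_matB.det_eq]; simp [matB]

lemma det_matC_ne_zero {a : K} (h2 : a - 2 ≠ 0) (h1 : 2 * a - 1 ≠ 0) : (matC a).det ≠ 0 := by
  rw [(isBlock_matC a).det_eq]
  have : (-4 * a + 2) * (4 * a - 2) * (0 * 0 - (2 * a - 4) * (2 * a - 4)) =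
    16 * (2 * a - 1) ^ 2 * (a - 2) ^ 2 := by ring
  simp only [matC]
  simp only [of_apply, cons_val', cons_val]
  rw [this]
  simp [h1, h2]

lemma preserves_of_eq_matA (a : K) {M : GL (Fin 4) K} (h : M.val = matA K) : Preserves a M := by
  refine ⟨16, by norm_num, fun v => ?_⟩
  rw [h]
  simp [matA, form, quartic, cubic, mulVec, dotProduct, Fin.sum_univ_four]
  ring

lemma preserves_of_eq_matB (a : K) {M : GL (Fin 4) K} (h : M.val = matB K) : Preserves a M := by
  refine ⟨-16, by norm_num, fun v => ?_⟩
  rw [h]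
  simp [matB, form, quartic, cubic, mulVec, dotProduct, Fin.sum_univ_four]
  ring

lemma preserves_of_eq_matC {a : K} (ha : a ^ 2 - a + 1 = 0) {M : GL (Fin 4) K}
    (h : M.val = matC a) : Preserves a M := by
  refine ⟨-144, by norm_num, fun v => ?_⟩
  -- Here a is a primitive sixth root of unity, so every power reduces to degree at most one.
  have a2 : a ^ 2 = a - 1 := by linear_combination ha
  have a3 : a ^ 3 = -1 := by linear_combination (a + 1) * ha
  have a4 : a ^ 4 = -a := by linear_combination a * a3
  have a5 : a ^ 5 = 1 - a := by linear_combination a ^ 2 * a3 - a2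
  have a6 : a ^ 6 = 1 := by linear_combination (a ^ 3 - 1) * a3
  rw [h]
  simp [matC, form, quartic, cubic, mulVec, dotProduct, Fin.sum_univ_four]
  ring_nf
  simp only [a2, a3, a4, a5, a6]
  ring

lemma actsBy_of_eq_matA {M : GL (Fin 4) K} (h : M.val = matA K) :
    ActsBy M (Equiv.swap 1 2 * Equiv.swap 0 1) 1 := by
  refine ⟨h ▸ isBlock_matA, fun i => ?_, ?_⟩
  · rw [h]
    fin_cases i
    · refine ⟨2, 0, by norm_num, ?_⟩
      rw [show (Equiv.swap 1 2 * Equiv.swap 0 1 : Equiv.Perm (Fin 3)) ((fun i => i) ⟨0, by simp⟩) = 2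
        by decide]
      ext j; fin_cases j <;> simp [matA, pt, apex]
    · refine ⟨2, 3, by norm_num, ?_⟩
      rw [show (Equiv.swap 1 2 * Equiv.swap 0 1 : Equiv.Perm (Fin 3)) ((fun i => i) ⟨1, by simp⟩) = 0
        by decide]
      ext j; fin_cases j <;> simp [matA, pt, apex]
    · refine ⟨-2, -3, by norm_num, ?_⟩
      rw [show (Equiv.swap 1 2 * Equiv.swap 0 1 : Equiv.Perm (Fin 3)) ((fun i => i) ⟨2, by simp⟩) = 1
        by decide]
      ext j; fin_cases j <;> simp [matA, pt, apex]
  · rw [h]; simp [matA]; norm_num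

lemma actsBy_of_eq_matB {M : GL (Fin 4) K} (h : M.val = matB K) :
    ActsBy M (Equiv.swap 1 2) 1 := by
  refine ⟨h ▸ isBlock_matB, fun i => ?_, ?_⟩
  · rw [h]
    fin_cases i
    · refine ⟨2, 0, by norm_num, ?_⟩
      rw [show (Equiv.swap 1 2 : Equiv.Perm (Fin 3)) ((fun i => i) ⟨0, by simp⟩) = 0 by decide]
      ext j; fin_cases j <;> simp [matB, pt, apex]
    · refine ⟨2, -3, by norm_num, ?_⟩
      rw [show (Equiv.swap 1 2 : Equiv.Perm (Fin 3)) ((fun i => i) ⟨1, by simp⟩) = 2 by decide]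
      ext j; fin_cases j <;> simp [matB, pt, apex]
    · refine ⟨2, 3, by norm_num, ?_⟩
      rw [show (Equiv.swap 1 2 : Equiv.Perm (Fin 3)) ((fun i => i) ⟨2, by simp⟩) = 1 by decide]
      ext j; fin_cases j <;> simp [matB, pt, apex]
  · rw [h]; simp [matB]; norm_num

lemma actsBy_of_eq_matC {a : K} (ha : a ^ 2 - a + 1 = 0) (h2 : a - 2 ≠ 0) (h1 : a - 1 ≠ 0)
    {M : GL (Fin 4) K} (h : M.val = matC a) : ActsBy M (Equiv.swap 0 1) (Units.mk0 (a - 1) h1) := by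
  have hc : 2 * a - 4 ≠ 0 := fun h => h2 (by linear_combination h / 2)
  refine ⟨h ▸ isBlock_matC a, fun i => ?_, ?_⟩
  · rw [h]
    fin_cases i
    · refine ⟨2 * a - 4, -3, hc, ?_⟩
      rw [show (Equiv.swap 0 1 : Equiv.Perm (Fin 3)) ((fun i => i) ⟨0, by simp⟩) = 1 by decide]
      ext j; fin_cases j <;> simp [matC, pt, apex]
    · refine ⟨2 * a - 4, -3 * a, hc, ?_⟩
      rw [show (Equiv.swap 0 1 : Equiv.Perm (Fin 3)) ((fun i => i) ⟨1, by simp⟩) = 0 by decide]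
      ext j; fin_cases j <;> simp [matC, pt, apex]
    · refine ⟨-(2 * a - 4), -3 + 3 * a, neg_ne_zero.2 hc, ?_⟩
      rw [show (Equiv.swap 0 1 : Equiv.Perm (Fin 3)) ((fun i => i) ⟨2, by simp⟩) = 2 by decide]
      ext j; fin_cases j <;> simp [matC, pt, apex]
  · rw [h]
    have a2 : a ^ 2 = a - 1 := by linear_combination ha
    have a3 : a ^ 3 = -1 := by linear_combination (a + 1) * ha
    have a4 : a ^ 4 = -a := by linear_combination a * a3
    have a5 : a ^ 5 = 1 - a := by linear_combination a ^ 2 * a3 - a2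
    simp [matC]
    ring_nf
    simp only [a2, a3, a4, a5]
    ring

lemma Q_eq_smul_Q' {a : K} (ha : a ^ 2 - a + 1 = 0) : Q a = (2 * a) • Q' K := by
  apply MvPolynomial.funext
  intro v
  rw [eval_Q, smul_eval]
  simp only [form, quartic, cubic, Q', map_add, map_sub, map_mul, map_pow, eval_X, eval_C, map_ofNat]
  have a2 : a ^ 2 = a - 1 := by linear_combination ha
  ring_nf
  simp only [a2]
  ring

end

/-! ### Generation and the isomorphism type -/

section

variable {K : Type*} [Field K] [CharZero K]

/-- A subgroup of the stabiliser is everything if it induces two transpositions of the flexes and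
contains the elements fixing the flexes. -/
lemma closure_eq_of_ker_le {P H : Type*} [Group P] [Group H] {G : Subgroup P}
    (φ : G →* Equiv.Perm (Fin 3) × H) (S : Set G)
    (h1 : (Equiv.swap 0 1) ∈ (Subgroup.closure S).map ((MonoidHom.fst _ _).comp φ))
    (h2 : (Equiv.swap 1 2) ∈ (Subgroup.closure S).map ((MonoidHom.fst _ _).comp φ))
    (hk : ∀ g, (φ g).1 = 1 → g ∈ Subgroup.closure S) :
    Subgroup.closure (Subtype.val '' S) = G ∧ Subgroup.closure S = ⊤ := by
  have h : Subgroup.closure S = ⊤ := by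
    rw [eq_top_iff]
    intro g _
    obtain ⟨k, hk', e⟩ := perm_fin_three_mem h1 h2 (φ g).1
    have e : (φ k).1 = (φ g).1 := e
    have : k⁻¹ * g ∈ Subgroup.closure S := hk _ (by rw [map_mul, map_inv]; simp [e])
    simpa using mul_mem hk' this
  refine ⟨?_, h⟩
  have := MonoidHom.map_closure G.subtype S
  rw [h, ← MonoidHom.range_eq_map, Subgroup.range_subtype] at this
  exact this.symm

theorem stabilizer_of_ne_zero {a : K} (ha : a ∉ ({-1, 0, 1 / 2, 1, 2} : Set K))
    (hj : a ^ 2 - a + 1 ≠ 0) {A B : GL (Fin 4) K} (hA : A.val = matA K) (hB : B.val = matB K) :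
    Nonempty (G a ≃* Equiv.Perm (Fin 3)) ∧
      Subgroup.closure {ProjGenLinGroup.mk A, ProjGenLinGroup.mk B} = G a := by
  obtain ⟨n1, n2, n3, n4, n5⟩ := excluded_ne_zero ha
  obtain ⟨φ, hφ, hker⟩ := exists_actionHom ha
  have mA := (mk_mem_G_iff n2 n3 n5 A).2 (preserves_of_eq_matA a hA)
  have mB := (mk_mem_G_iff n2 n3 n5 B).2 (preserves_of_eq_matB a hB)
  have eA := hφ A mA _ _ (actsBy_of_eq_matA hA)
  have eB := hφ B mB _ _ (actsBy_of_eq_matB hB)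
  have hk (g : G a) (hg : (φ g).1 = 1) : g = 1 := (hker g hg).2.2 ((hker g hg).2.1 hj)
  let ψ : G a →* Equiv.Perm (Fin 3) := (MonoidHom.fst _ _).comp φ
  obtain ⟨S, hS⟩ : ∃ S : Set (G a), S = {⟨_, mA⟩, ⟨_, mB⟩} := ⟨_, rfl⟩
  have s2 : Equiv.swap 1 2 ∈ (Subgroup.closure S).map ψ :=
    ⟨⟨_, mB⟩, Subgroup.subset_closure (by simp [hS]), congrArg Prod.fst eB⟩
  have s1 : Equiv.swap 0 1 ∈ (Subgroup.closure S).map ψ := by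
    have h : Equiv.swap 1 2 * Equiv.swap 0 1 ∈ (Subgroup.closure S).map ψ :=
      ⟨⟨_, mA⟩, Subgroup.subset_closure (by simp [hS]), congrArg Prod.fst eA⟩
    exact (Subgroup.mul_mem_cancel_left _ s2).1 h
  refine ⟨⟨MulEquiv.ofBijective ψ ⟨?_, fun σ => ?_⟩⟩, ?_⟩
  · rw [injective_iff_map_eq_one]
    exact hk
  · obtain ⟨g, -, hg⟩ := perm_fin_three_mem s1 s2 σ
    exact ⟨g, hg⟩
  · have := (closure_eq_of_ker_le φ S s1 s2 fun g hg => hk g hg ▸ one_mem _).1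
    rwa [hS, Set.image_pair] at this

theorem stabilizer_of_eq_zero {a : K} (ha : a ∉ ({-1, 0, 1 / 2, 1, 2} : Set K))
    (hj : a ^ 2 - a + 1 = 0) {B C : GL (Fin 4) K} (hB : B.val = matB K) (hC : C.val = matC a) :
    Nonempty (G a ≃* Equiv.Perm (Fin 3) × Multiplicative (ZMod 3)) ∧
      Subgroup.closure {ProjGenLinGroup.mk B, ProjGenLinGroup.mk C} = G a := by
  obtain ⟨n1, n2, n3, n4, n5⟩ := excluded_ne_zero ha
  obtain ⟨φ, hφ, hker⟩ := exists_actionHom ha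
  have mB := (mk_mem_G_iff n2 n3 n5 B).2 (preserves_of_eq_matB a hB)
  have mC := (mk_mem_G_iff n2 n3 n5 C).2 (preserves_of_eq_matC hj hC)
  have eB := hφ B mB _ _ (actsBy_of_eq_matB hB)
  have eC := hφ C mC _ _ (actsBy_of_eq_matC hj n5 n4 hC)
  obtain ⟨ζ, hζ⟩ : ∃ ζ, ζ = Units.mk0 (a - 1) n4 := ⟨_, rfl⟩
  rw [← hζ] at eC
  have hζ3 : ζ ^ 3 = 1 := by
    ext
    simp only [hζ, Units.val_pow_eq_pow_val, Units.val_mk0, Units.val_one]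
    linear_combination (a - 2) * hj
  have hζ1 : ζ ≠ 1 := by
    intro h
    have := congrArg Units.val h
    simp only [hζ, Units.val_mk0, Units.val_one] at this
    exact n5 (by linear_combination this)
  have hord : orderOf ζ = 3 := orderOf_eq_prime hζ3 hζ1
  have hprim : IsPrimitiveRoot ζ 3 := hord ▸ IsPrimitiveRoot.orderOf ζ
  let ψ : G a →* Equiv.Perm (Fin 3) := (MonoidHom.fst _ _).comp φ
  let χ : G a →* Kˣ := (MonoidHom.snd _ _).comp φ
  let B' : G a := ⟨_, mB⟩
  let C' : G a := ⟨_, mC⟩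
  -- The fourth power kills the transposition and keeps ζ, since ζ⁴ = ζ. Thus it generates the
  -- kernel of the permutation action.
  have eC4 : φ (C' ^ 4) = (1, ζ) := by
    have h4 : (Equiv.swap 0 1 : Equiv.Perm (Fin 3)) ^ 4 = 1 := by decide
    rw [map_pow, eC, Prod.pow_mk, h4, pow_succ, hζ3, one_mul]
  obtain ⟨S, hS⟩ : ∃ S : Set (G a), S = {B', C'} := ⟨_, rfl⟩
  have hCS : C' ∈ Subgroup.closure S := Subgroup.subset_closure (by simp [hS])
  have s2 : Equiv.swap 1 2 ∈ (Subgroup.closure S).map ψ :=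
    ⟨B', Subgroup.subset_closure (by simp [hS]), congrArg Prod.fst eB⟩
  have s1 : Equiv.swap 0 1 ∈ (Subgroup.closure S).map ψ := ⟨C', hCS, congrArg Prod.fst eC⟩
  have hk (g : G a) (hg : (φ g).1 = 1) : g ∈ Subgroup.closure S := by
    obtain ⟨n, -, hn⟩ := (IsPrimitiveRoot.coe_units_iff.2 hprim).eq_pow_of_pow_eq_one
      (ξ := ((φ g).2 : K)) (by rw [← Units.val_pow_eq_pow_val, (hker g hg).1, Units.val_one])
    have hn : ζ ^ n = (φ g).2 := by ext; simpa using hn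
    have h1 : φ (((C' ^ 4) ^ n)⁻¹ * g) = 1 := by
      rw [map_mul, map_inv, map_pow, eC4, Prod.pow_mk, one_pow, hn]
      ext1 <;> simp [hg]
    have h2 : ((C' ^ 4) ^ n)⁻¹ * g = 1 :=
      (hker _ (by rw [h1]; rfl)).2.2 (by rw [h1]; rfl)
    rw [inv_mul_eq_one] at h2
    exact h2 ▸ pow_mem (pow_mem hCS 4) n
  obtain ⟨hcl, htop⟩ := closure_eq_of_ker_le φ S s1 s2 hk
  -- The character takes values in ⟨ζ⟩ on the generators, hence everywhere.
  have hχ (g : G a) : χ g ∈ Subgroup.zpowers ζ := by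
    have : Subgroup.closure S ≤ (Subgroup.zpowers ζ).comap χ := by
      rw [Subgroup.closure_le, hS]
      rintro g (rfl | rfl)
      · change (φ B').2 ∈ Subgroup.zpowers ζ
        rw [eB]
        exact one_mem _
      · change (φ C').2 ∈ Subgroup.zpowers ζ
        rw [eC]
        exact Subgroup.mem_zpowers ζ
    exact this (htop ▸ Subgroup.mem_top g)
  let θ : G a →* Equiv.Perm (Fin 3) × Subgroup.zpowers ζ := ψ.prod (χ.codRestrict _ hχ)
  have hθ : Function.Bijective θ := by
    constructor
    · rw [injective_iff_map_eq_one]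
      intro g hg
      exact (hker g (congrArg Prod.fst hg)).2.2
        (congrArg Subtype.val (congrArg Prod.snd hg))
    · rintro ⟨σ, w, n, hn⟩
      obtain ⟨g, -, hg⟩ := perm_fin_three_mem s1 s2 σ
      obtain ⟨m, hm⟩ := hχ g
      have hg : (φ g).1 = σ := hg
      have hm : (φ g).2 = ζ ^ m := hm.symm
      have hn : ζ ^ n = w := hn
      have h1 : φ (g * (C' ^ 4) ^ (n - m)) = (σ, w) := by
        rw [map_mul, map_zpow, eC4, Prod.pow_mk, _root_.one_zpow]
        ext1
        · simp [hg]
        · rw [Prod.snd_mul, hm, ← hn, ← _root_.zpow_add]; congr 1; ring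
      refine ⟨g * (C' ^ 4) ^ (n - m), Prod.ext ?_ (Subtype.ext ?_)⟩
      · have := congrArg Prod.fst h1
        exact this
      · have := congrArg Prod.snd h1
        exact this
  have e3 : Subgroup.zpowers ζ ≃* Multiplicative (ZMod 3) :=
    mulEquivOfPrimeCardEq (p := 3) (by rw [Nat.card_zpowers, hord])
      (by rw [Nat.card_congr Multiplicative.toAdd, Nat.card_zmod])
  refine ⟨⟨(MulEquiv.ofBijective θ hθ).trans (MulEquiv.prodCongr (MulEquiv.refl _) e3)⟩, ?_⟩
  rwa [hS, Set.image_pair] at hcl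

end

end QuarticMonoid

theorem mainTheorem2 {K : Type*} [Field K] [CharZero K] (a : K)
    (ha : a ∉ ({-1, 0, 1 / 2, 1, 2} : Set K)) :
    -- the surfaces of `M · Q(a)` and `Q(a)` coincide iff the forms are proportional
    (∀ M : GL (Fin 4) K, Matrix.ProjGenLinGroup.mk M ∈ QuarticMonoid.G a ↔
      ∃ c : K, c ≠ 0 ∧ QuarticMonoid.act M (QuarticMonoid.Q a) = c • QuarticMonoid.Q a) ∧
    (a ^ 2 - a + 1 ≠ 0 →
      Nonempty (QuarticMonoid.G a ≃* Equiv.Perm (Fin 3)) ∧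
      ∃ A B : GL (Fin 4) K,
        A.val = !![ 2,  2, 2,  0;
                    0, -2, 0,  0;
                   -2,  0, 0,  0;
                    0,  1, 3, -2] ∧
        B.val = !![2,  2,  2, 0;
                   0, -2,  0, 0;
                   0,  0, -2, 0;
                   0, -2, -3, 2] ∧
        Subgroup.closure {Matrix.ProjGenLinGroup.mk A, Matrix.ProjGenLinGroup.mk B} =
          QuarticMonoid.G a) ∧
    (a ^ 2 - a + 1 = 0 →
      (∃ c : K, c ≠ 0 ∧ QuarticMonoid.Q a = c • QuarticMonoid.Q' K) ∧
      Nat.card (QuarticMonoid.G a) = 18 ∧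
      Nonempty (QuarticMonoid.G a ≃* Equiv.Perm (Fin 3) × Multiplicative (ZMod 3)) ∧
      ∃ B C : GL (Fin 4) K,
        B.val = !![2,  2,  2, 0;
                   0, -2,  0, 0;
                   0,  0, -2, 0;
                   0, -2, -3, 2] ∧
        C.val = !![0,         2 * a - 2,  2 * a - 4, 0;
                   0,         -4 * a + 2, 0,         0;
                   2 * a - 4, 2 * a - 2,  0,         0;
                   -3,        -3 * a,     -3 * a,    4 * a - 2] ∧
        Subgroup.closure {Matrix.ProjGenLinGroup.mk B, Matrix.ProjGenLinGroup.mk C} =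
          QuarticMonoid.G a) := by
  obtain ⟨n1, n2, n3, n4, n5⟩ := QuarticMonoid.excluded_ne_zero ha
  let A := GeneralLinearGroup.mkOfDetNeZero _ (QuarticMonoid.det_matA_ne_zero (K := K))
  let B := GeneralLinearGroup.mkOfDetNeZero _ (QuarticMonoid.det_matB_ne_zero (K := K))
  let C := GeneralLinearGroup.mkOfDetNeZero _ (QuarticMonoid.det_matC_ne_zero n5 n3)
  refine ⟨fun M => ?_, fun hj => ?_, fun hj => ?_⟩
  · rw [QuarticMonoid.act_Q_eq_smul_iff, QuarticMonoid.mk_mem_G_iff n2 n3 n5]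
  · obtain ⟨h1, h2⟩ := QuarticMonoid.stabilizer_of_ne_zero ha hj (A := A) (B := B) rfl rfl
    exact ⟨h1, A, B, rfl, rfl, h2⟩
  · obtain ⟨⟨e⟩, h2⟩ := QuarticMonoid.stabilizer_of_eq_zero ha hj (B := B) (C := C) rfl rfl
    refine ⟨⟨2 * a, by simp [n2], QuarticMonoid.Q_eq_smul_Q' hj⟩, ?_, ⟨e⟩, B, C, rfl, rfl, h2⟩
    rw [Nat.card_congr e.toEquiv, Nat.card_prod, Nat.card_congr Multiplicative.toAdd,
      Nat.card_zmod, Nat.card_eq_fintype_card, Fintype.card_perm]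
    rfl
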